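/- A *finite quantum group* is a finite-dimensional unital $C^*$-algebra $A$ with a coassociative unital $*$-homomorphism $\Phi:A\to A\otimes A$ (coproduct), a unital $*$-homomorphism $\epsilon:A\to\mathbb C$ (counit) with $(\epsilon\otimes id)\Phi=id=(id\otimes\epsilon)\Phi$, and an involutive $*$-preserving linear anti-automorphism $\kappa$ of $A$ (antipode) with $m(\kappa\otimes id)\Phi=\epsilon(\cdot)1=m(id\otimes\kappa)\Phi$, where $m$ is the multiplication. Its unital $*$-homomorphisms $A\to\mathbb C$ form a group $X(A)$ under $\chi\cdot\psi=(\chi\otimes\psi)\Phi$, with unit $\epsilon$. Let $A$ be a finite quantum group, and let $T$ be a finite abelian group, written additively, which is a subgroup of $X(A)$; write $E_t\pi:A\to\mathbb C$ for the character $t\in T$. Let $\langle\cdot,\cdot\rangle:T\times T\to\mathbb T$ be a Pontryagin pairing, i.e. a symmetric bicharacter that identifies $T$ with its Pontryagin dual, and let $S$ be an automorphism of $T$ with $S^t=-S$, i.e. $\langle Ss,t\rangle=\langle s,-St\rangle$ for all $s,t\in T$. On $H=T\oplus T$ take the pairing $\langle(s,u),(t,v)\rangle=\langle s,t\rangle\langle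 u,v\rangle$ and $J=S\oplus(-S)$, and let $H$ act on $A$ by $\alpha_{(s,u)}=\lambda_s\rho_u$, where $\lambda_s=(E_{-s}\pi\otimes id)\Phi$ and $\rho_u=(id\otimes E_u\pi)\Phi$. Define a new product on the vector space $A$ by $$a\times_J b=\frac1{|T|^2}\sum_{s,u,t,v\in T}\langle Ss,t\rangle\,\langle -Su,v\rangle\,\alpha_{(s,u)}(a)\,\alpha_{(t,v)}(b).$$ **Theorem 3.2.** 1. If $\langle Ss,s\rangle=1$ for all $s\in T$ (which is automatic when $|T|$ is odd), then $(A,\times_J)$ with the original unit, involution, coproduct, counit and antipode of $A$ is again a finite quantum group, and it contains $T$ as a subgroup through the same characters $E_t\pi$. 2. Without this condition on $S$, there are still an involution and an antipode on the vector space $A$ which, together with the product $\times_J$ and the original unit, coproduct and counit of $A$, make it a finite quantum group, and it contains $T$ as a subgroup through the same characters $E_t\pi$. -/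

import Mathlib

open scoped TensorProduct

universe u v

/-- A finite quantum group, given by its function algebra: a finite-dimensional Hopf
C*-algebra. Here `A` is a finite-dimensional unital C*-algebra, the coproduct `comul` is a
coassociative unital `*`-homomorphism, the counit `counit` is a unital `*`-homomorphism, and the
antipode is an involutive `*`-preserving anti-automorphism satisfying the antipode identities. -/
class FiniteQuantumGroup (A : Type u) extends CStarAlgebra A, Coalgebra ℂ A where
  finiteDimensional : FiniteDimensional ℂ A
  comul_one : comul (1 : A) = (1 : A ⊗[ℂ] A)
  comul_mul : ∀ a b : A, comul (a * b) = (comul a * comul b : A ⊗[ℂ] A)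
  comul_star : ∀ a : A, comul (star a) = (Star.star (comul a) : A ⊗[ℂ] A)
  counit_one : counit (1 : A) = (1 : ℂ)
  counit_mul : ∀ a b : A, counit (a * b) = (counit a * counit b : ℂ)
  counit_star : ∀ a : A, counit (star a) = (Star.star (counit a) : ℂ)
  antipode : A →ₗ[ℂ] A
  antipode_mul : ∀ a b : A, antipode (a * b) = antipode b * antipode a
  antipode_star : ∀ a : A, antipode (star a) = star (antipode a)
  antipode_antipode : ∀ a : A, antipode (antipode a) = a
  mul_antipode_rTensor_comul : ∀ a : A,
    LinearMap.mul' ℂ A (antipode.rTensor A (comul a)) = counit a • (1 : A)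
  mul_antipode_lTensor_comul : ∀ a : A,
    LinearMap.mul' ℂ A (antipode.lTensor A (comul a)) = counit a • (1 : A)

/-- The additive abelian group `T` as a subgroup of the group of characters
`X(A) = {*-homomorphisms A → ℂ}` of the quantum group `A`, whose group operation is the convolution
`χ · ψ = (χ ⊗ ψ) Φ` and whose neutral element is the counit. The value at `t` of the embedding is
`E_t ∘ π`, where `π : A → C(T)` is restriction to `T` and `E_t` is evaluation at `t`. -/
structure CharacterSubgroup (T : Type v) [AddCommGroup T] (A : Type u)
    [FiniteQuantumGroup A] where
  toCharacter : T → (A →⋆ₐ[ℂ] ℂ)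
  injective : Function.Injective toCharacter
  map_zero : ∀ a : A, toCharacter 0 a = (Coalgebra.counit a : ℂ)
  map_add : ∀ (s t : T) (a : A), toCharacter (s + t) a =
    LinearMap.mul' ℂ ℂ (TensorProduct.map (toCharacter s : A →ₗ[ℂ] ℂ)
      (toCharacter t : A →ₗ[ℂ] ℂ) (Coalgebra.comul a))

/-- A Pontryagin pairing on a finite abelian group `H`: a symmetric circle-valued bicharacter
which identifies `H` with its Pontryagin dual. -/
structure PontryaginPairing (H : Type v) [AddCommGroup H] where
  toFun : H → H → Circle
  map_add_left : ∀ s s' t : H, toFun (s + s') t = toFun s t * toFun s' t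
  symm : ∀ s t : H, toFun s t = toFun t s
  nondegenerate : ∀ s : H, (∀ t : H, toFun s t = 1) → s = 0

namespace PontryaginPairing

variable {H : Type v} [AddCommGroup H] (p : PontryaginPairing H)

/-- `J` is skew-symmetric, `Jᵗ = -J`, where the transpose is defined by `⟨J s, t⟩ = ⟨s, Jᵗ t⟩`. -/
def IsSkewSymmetric (J : H →+ H) : Prop :=
  ∀ s t : H, p.toFun (J s) t = p.toFun s (-(J t))

theorem toFun_zero_right (s : H) : p.toFun s 0 = 1 := by
  have h := p.map_add_left 0 0 s
  rw [add_zero] at h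
  rw [p.symm]
  exact left_eq_mul.mp h

/-- The pairing `⟨(s, u), (t, v)⟩ = ⟨s, t⟩ ⟨u, v⟩` on `H ⊕ H`. -/
noncomputable def prod : PontryaginPairing (H × H) where
  toFun x y := p.toFun x.1 y.1 * p.toFun x.2 y.2
  map_add_left s s' t := by
    simp only [Prod.fst_add, Prod.snd_add, p.map_add_left]
    exact mul_mul_mul_comm _ _ _ _
  symm s t := by rw [p.symm s.1, p.symm s.2]
  nondegenerate s h := by
    refine Prod.ext (p.nondegenerate _ fun t => ?_) (p.nondegenerate _ fun t => ?_)
    · simpa [p.toFun_zero_right] using h (t, 0)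
    · simpa [p.toFun_zero_right] using h (0, t)

end PontryaginPairing

/-- The normalized Haar integral on a finite group. -/
noncomputable def haarIntegral {H : Type v} [Fintype H] {V : Type u} [AddCommGroup V]
    [Module ℂ V] (f : H → V) : V :=
  (Fintype.card H : ℂ)⁻¹ • ∑ s, f s

/-- The deformed product `a ×_J b = |H| ∫ₛ ∫ₜ ⟨J s, t⟩ α_s(a) α_t(b)`. -/
noncomputable def deformedProduct {H : Type v} [AddCommGroup H] [Fintype H] {A : Type u}
    [CStarAlgebra A] (p : PontryaginPairing H) (J : H →+ H) (α : H → A → A) (a b : A) : A :=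
  (Fintype.card H : ℂ) •
    haarIntegral fun s : H => haarIntegral fun t : H =>
      (p.toFun (J s) t : ℂ) • (α s a * α t b)

namespace CharacterSubgroup

variable {T : Type v} [AddCommGroup T] {A : Type u} [FiniteQuantumGroup A]
  (ι : CharacterSubgroup T A)

/-- Left translation `λ_s = (E_{-s} π ⊗ id) Φ`. -/
noncomputable def leftTranslation (s : T) (a : A) : A :=
  TensorProduct.lid ℂ A ((ι.toCharacter (-s) : A →ₗ[ℂ] ℂ).rTensor A (Coalgebra.comul a))

/-- Right translation `ρ_u = (id ⊗ E_u π) Φ`. -/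
noncomputable def rightTranslation (u : T) (a : A) : A :=
  TensorProduct.rid ℂ A ((ι.toCharacter u : A →ₗ[ℂ] ℂ).lTensor A (Coalgebra.comul a))

/-- The action `α_(s, u) = λ_s ρ_u` of `T ⊕ T` on `A`. -/
noncomputable def action (x : T × T) (a : A) : A :=
  ι.leftTranslation x.1 (ι.rightTranslation x.2 a)

/-- The product `×_J` on `A`, for `J = S ⊕ (-S)` on `H = T ⊕ T`. -/
noncomputable def product [Fintype T] (p : PontryaginPairing T) (S : T →+ T) (a b : A) : A :=
  deformedProduct p.prod (S.prodMap (-S)) ι.action a b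

/-- The vector space `A` with the product `mul`, the involution `inv` and the antipode `κ`, and
with the original unit, coproduct and counit of `A`, is a finite quantum group, of which `T` is a
subgroup through the same characters as for `A`. This means that this structure is transported by
some linear isomorphism `e` to the structure of a finite quantum group `B`. -/
def DeformsTo (mul : A → A → A) (inv : A → A) (κ : A → A) : Prop :=
  ∃ (B : Type u) (_ : FiniteQuantumGroup B) (e : A ≃ₗ[ℂ] B) (ι' : CharacterSubgroup T B),
    (∀ a b : A, e (mul a b) = e a * e b) ∧
    e 1 = 1 ∧
    (∀ a : A, e (inv a) = star (e a)) ∧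
    (∀ a : A, Coalgebra.comul (R := ℂ) (e a) =
      TensorProduct.map (e : A →ₗ[ℂ] B) (e : A →ₗ[ℂ] B) (Coalgebra.comul a)) ∧
    (∀ a : A, Coalgebra.counit (R := ℂ) (e a) = Coalgebra.counit (R := ℂ) a) ∧
    (∀ a : A, FiniteQuantumGroup.antipode (e a) = e (κ a)) ∧
    (∀ (t : T) (a : A), ι'.toCharacter t (e a) = ι.toCharacter t a)

end CharacterSubgroup

namespace PontryaginPairing

variable {H : Type v} [AddCommGroup H] (p : PontryaginPairing H)

theorem map_add_right (s t t' : H) : p.toFun s (t + t') = p.toFun s t * p.toFun s t' := by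
  rw [p.symm, p.map_add_left, p.symm t, p.symm t']

theorem toFun_zero_left (s : H) : p.toFun 0 s = 1 := by
  rw [p.symm, p.toFun_zero_right]

theorem toFun_neg_left (s t : H) : p.toFun (-s) t = (p.toFun s t)⁻¹ := by
  rw [eq_inv_iff_mul_eq_one, ← p.map_add_left, neg_add_cancel, p.toFun_zero_left]

theorem toFun_neg_right (s t : H) : p.toFun s (-t) = (p.toFun s t)⁻¹ := by
  rw [p.symm, p.toFun_neg_left, p.symm]

/-- The complex character `s ↦ ⟨s, x⟩` of `H`. -/
noncomputable def toAddChar (x : H) : AddChar H ℂ where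
  toFun s := p.toFun s x
  map_zero_eq_one' := by simp [p.toFun_zero_left]
  map_add_eq_mul' s t := by simp [p.map_add_left]

@[simp] theorem toAddChar_apply (x s : H) : p.toAddChar x s = p.toFun s x := rfl

theorem toAddChar_eq_zero_iff {x : H} : p.toAddChar x = 0 ↔ x = 0 := by
  constructor
  · intro h
    refine p.nondegenerate x fun t => ?_
    have := DFunLike.congr_fun h t
    rw [p.symm]
    exact Circle.ext this
  · rintro rfl
    ext s
    simp [p.toFun_zero_right]

theorem sum_toFun [Fintype H] [DecidableEq H] (x : H) :
    ∑ s, (p.toFun s x : ℂ) = if x = 0 then (Fintype.card H : ℂ) else 0 := by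
  classical
  simpa [p.toAddChar_eq_zero_iff] using AddChar.sum_eq_ite (p.toAddChar x)

section Spectral

variable {V : Type u} [AddCommGroup V] [Module ℂ V] (β : AddChar H (Module.End ℂ V))

/-- The vector `v` lies in the spectral subspace of degree `x` of the representation `β` of `H`,
where the pairing identifies `H` with its dual. -/
def IsHomogeneous (x : H) (v : V) : Prop :=
  ∀ s, β s v = (p.toFun s x : ℂ) • v

variable [Fintype H]

/-- The projection on the spectral subspace of degree `x`. -/
noncomputable def spectralProj (x : H) : Module.End ℂ V :=
  (Fintype.card H : ℂ)⁻¹ • ∑ s, (p.toFun (-s) x : ℂ) • β s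

theorem spectralProj_apply (x : H) (v : V) :
    p.spectralProj β x v = (Fintype.card H : ℂ)⁻¹ • ∑ s, (p.toFun (-s) x : ℂ) • β s v := by
  simp [spectralProj]

variable {p β}

theorem IsHomogeneous.spectralProj_apply [DecidableEq H] {x : H} {v : V}
    (h : p.IsHomogeneous β x v) (y : H) :
    p.spectralProj β y v = if x = y then v else 0 := by
  have h0 : (Fintype.card H : ℂ) ≠ 0 := by simp
  have key : ∀ s, (p.toFun (-s) y : ℂ) • β s v = (p.toFun s (x - y) : ℂ) • v := fun s => by
    rw [h s, smul_smul, ← Circle.coe_mul, sub_eq_add_neg, p.map_add_right, p.toFun_neg_right,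
      p.toFun_neg_left, mul_comm]
  simp_rw [PontryaginPairing.spectralProj_apply, key, ← Finset.sum_smul, p.sum_toFun, sub_eq_zero]
  split_ifs
  · rw [smul_smul, inv_mul_cancel₀ h0, one_smul]
  · simp

variable (p β)

theorem isHomogeneous_spectralProj (x : H) (v : V) :
    p.IsHomogeneous β x (p.spectralProj β x v) := by
  intro s
  rw [p.spectralProj_apply, LinearMap.map_smul, map_sum,
    smul_comm (p.toFun s x : ℂ), Finset.smul_sum (r := (p.toFun s x : ℂ))]
  refine congrArg _ (Fintype.sum_equiv (Equiv.addLeft s) _ _ fun t => ?_)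
  rw [LinearMap.map_smul, ← Module.End.mul_apply, ← AddChar.map_add_eq_mul, smul_smul, ← Circle.coe_mul,
    Equiv.coe_addLeft, ← p.map_add_left]
  congr 3
  change -t = s + -(s + t)
  abel

theorem sum_spectralProj (v : V) : ∑ x, p.spectralProj β x v = v := by
  classical
  have h0 : (Fintype.card H : ℂ) ≠ 0 := by simp
  simp_rw [p.spectralProj_apply, ← Finset.smul_sum]
  rw [Finset.sum_comm]
  simp_rw [← Finset.sum_smul, p.symm, p.sum_toFun, neg_eq_zero, ite_smul, zero_smul,
    Finset.sum_ite_eq', Finset.mem_univ, if_true, AddChar.map_zero_eq_one, smul_smul,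
    inv_mul_cancel₀ h0, one_smul]
  rfl

variable {p β} in
/-- Linear maps which agree on all spectral subspaces are equal. -/
theorem ext_homogeneous {W : Type*} [AddCommMonoid W] [Module ℂ W] {f g : V →ₗ[ℂ] W}
    (h : ∀ x v, p.IsHomogeneous β x v → f v = g v) : f = g := by
  ext v
  rw [← p.sum_spectralProj β v, map_sum, map_sum]
  exact Finset.sum_congr rfl fun x _ => h x _ (p.isHomogeneous_spectralProj β x v)

end Spectral

variable {p} {V : Type u} [AddCommGroup V] [Module ℂ V] {β : AddChar H (Module.End ℂ V)}

theorem IsHomogeneous.smul {x : H} {v : V} (h : p.IsHomogeneous β x v) (c : ℂ) :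
    p.IsHomogeneous β x (c • v) := fun s => by rw [map_smul, h s, smul_comm]

theorem eq_zero_of_smul_eq_smul {W : Type*} [AddCommGroup W] [Module ℂ W] {x y : H} {w : W}
    (hxy : x ≠ y) (h : ∀ s, (p.toFun s x : ℂ) • w = (p.toFun s y : ℂ) • w) : w = 0 := by
  by_contra hw
  refine hxy (sub_eq_zero.mp (p.nondegenerate _ fun t => ?_))
  rw [p.symm, sub_eq_add_neg, p.map_add_right, p.toFun_neg_right, mul_inv_eq_one]
  exact Circle.ext (smul_left_injective ℂ hw (h t))

end PontryaginPairing

namespace PontryaginPairing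

variable {H : Type v} [AddCommGroup H] (p : PontryaginPairing H) (K : H →+ H)

/-- The bicharacter `(x, y) ↦ ⟨-K y, x⟩`. For `K = J⁻¹` this is the factor by which the deformed
product of elements of degrees `x` and `y` differs from the original one. -/
def twist (x y : H) : Circle := p.toFun (-(K y)) x

theorem twist_add_left (x x' y : H) : p.twist K (x + x') y = p.twist K x y * p.twist K x' y :=
  p.map_add_right _ _ _

theorem twist_add_right (x y y' : H) : p.twist K x (y + y') = p.twist K x y * p.twist K x y' := by
  simp only [twist, map_add, neg_add, p.map_add_left]

theorem twist_zero_left (y : H) : p.twist K 0 y = 1 := p.toFun_zero_right _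

theorem twist_zero_right (x : H) : p.twist K x 0 = 1 := by
  simp [twist, p.toFun_zero_left]

theorem twist_neg_left (x y : H) : p.twist K (-x) y = (p.twist K x y)⁻¹ :=
  p.toFun_neg_right _ _

theorem twist_neg_right (x y : H) : p.twist K x (-y) = (p.twist K x y)⁻¹ := by
  simp only [twist, map_neg, p.toFun_neg_left]

variable {p K}

theorem twist_swap (hK : p.IsSkewSymmetric K) (x y : H) :
    p.twist K y x = (p.twist K x y)⁻¹ := by
  rw [twist, twist, p.toFun_neg_left, hK, p.symm, p.toFun_neg_left]

theorem twist_self_inv (hK : p.IsSkewSymmetric K) (x : H) :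
    (p.twist K x x)⁻¹ = p.twist K x x := (twist_swap hK x x).symm

theorem twist_self_mul_self (hK : p.IsSkewSymmetric K) (x : H) :
    p.twist K x x * p.twist K x x = 1 :=
  mul_eq_one_iff_eq_inv.mpr (twist_swap hK x x)

theorem twist_self_add (hK : p.IsSkewSymmetric K) (x y : H) :
    p.twist K (x + y) (x + y) = p.twist K x x * p.twist K y y := by
  rw [twist_add_left, twist_add_right, twist_add_right, twist_swap hK x y]
  group

section Multiplier

variable {V : Type u} [AddCommGroup V] [Module ℂ V] (p) (β : AddChar H (Module.End ℂ V))
  [Fintype H]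

/-- The operator which is multiplication by `c x` on the spectral subspace of degree `x`. -/
noncomputable def spectralMultiplier (c : H → ℂ) : Module.End ℂ V :=
  ∑ x, c x • p.spectralProj β x

variable {p β} in
theorem IsHomogeneous.spectralMultiplier_apply {x : H} {v : V} (h : p.IsHomogeneous β x v)
    (c : H → ℂ) : p.spectralMultiplier β c v = c x • v := by
  classical
  simp [spectralMultiplier, h.spectralProj_apply]

theorem spectralMultiplier_one : p.spectralMultiplier β 1 = 1 :=
  ext_homogeneous (p := p) (β := β) fun x v h => by simp [h.spectralMultiplier_apply]

end Multiplier

end PontryaginPairing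

/-- A representation of `H` on a unital `*`-algebra by unital `*`-homomorphisms. -/
structure IsStarAction {H : Type v} [AddCommGroup H] {A : Type u} [Ring A] [StarRing A]
    [Algebra ℂ A] (α : AddChar H (Module.End ℂ A)) : Prop where
  map_mul : ∀ s a b, α s (a * b) = α s a * α s b
  map_one : ∀ s, α s 1 = 1
  map_star : ∀ s a, α s (star a) = star (α s a)

namespace PontryaginPairing

variable {H : Type v} [AddCommGroup H] {p : PontryaginPairing H} {K : H →+ H}

section StarAction

variable {A : Type u} [Ring A] [StarRing A] [Algebra ℂ A]
  {α : AddChar H (Module.End ℂ A)}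

theorem IsHomogeneous.mul (hα : IsStarAction α) {x y : H} {a b : A} (ha : p.IsHomogeneous α x a)
    (hb : p.IsHomogeneous α y b) : p.IsHomogeneous α (x + y) (a * b) := fun s => by
  rw [hα.map_mul, ha s, hb s, smul_mul_smul_comm, p.map_add_right, Circle.coe_mul]

theorem isHomogeneous_one (hα : IsStarAction α) : p.IsHomogeneous α 0 (1 : A) := fun s => by
  rw [hα.map_one, p.toFun_zero_right, Circle.coe_one, one_smul]

variable [StarModule ℂ A]

theorem IsHomogeneous.star (hα : IsStarAction α) {x : H} {a : A} (ha : p.IsHomogeneous α x a) :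
    p.IsHomogeneous α (-x) (star a) := fun s => by
  rw [hα.map_star, ha s, star_smul, p.toFun_neg_right, Circle.coe_inv_eq_conj, starRingEnd_apply]

theorem star_spectralProj [Fintype H] (hα : IsStarAction α) (x : H) (a : A) :
    star (p.spectralProj α x a) = p.spectralProj α (-x) (star a) := by
  rw [p.spectralProj_apply, p.spectralProj_apply, star_smul, star_sum]
  congr 1
  · simp
  · refine Finset.sum_congr rfl fun s _ => ?_
    rw [star_smul, hα.map_star, p.toFun_neg_right, Circle.coe_inv_eq_conj, starRingEnd_apply]

end StarAction

section CStar

variable {A : Type u} [CStarAlgebra A] (α : AddChar H (Module.End ℂ A)) [Fintype H] (p)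

/-- The deformed product, as a bilinear map. -/
noncomputable def deformedMul (J : H →+ H) : A →ₗ[ℂ] A →ₗ[ℂ] A :=
  (Fintype.card H : ℂ) • (Fintype.card H : ℂ)⁻¹ • ∑ s, (Fintype.card H : ℂ)⁻¹ • ∑ t,
    (p.toFun (J s) t : ℂ) • (LinearMap.mul ℂ A).compl₁₂ (α s) (α t)

theorem deformedMul_apply (J : H →+ H) (a b : A) :
    p.deformedMul α J a b = deformedProduct p J (fun s => α s) a b := by
  simp [deformedMul, deformedProduct, haarIntegral, LinearMap.sum_apply]

variable {p α}

theorem deformedMul_of_homogeneous {J : H →+ H} (hJK : ∀ x, J (K x) = x)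
    (hKJ : ∀ x, K (J x) = x) {x y : H} {a b : A} (ha : p.IsHomogeneous α x a)
    (hb : p.IsHomogeneous α y b) :
    p.deformedMul α J a b = (p.twist K x y : ℂ) • (a * b) := by
  classical
  have h0 : (Fintype.card H : ℂ) ≠ 0 := by simp
  have key : ∀ s t, (p.toFun (J s) t : ℂ) • (α s a * α t b) =
      (p.toFun t (J s + y) : ℂ) • (p.toFun s x : ℂ) • (a * b) := fun s t => by
    rw [ha s, hb t, smul_mul_smul_comm, smul_smul, smul_smul, p.map_add_right,
      p.symm t (J s), Circle.coe_mul]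
    congr 1
    ring
  have hs : ∀ s, J s + y = 0 ↔ s = -(K y) := fun s => by
    rw [add_eq_zero_iff_eq_neg]
    constructor
    · intro h
      rw [← hKJ s, h, map_neg]
    · rintro rfl
      rw [map_neg, hJK]
  rw [deformedMul_apply]
  simp only [deformedProduct, haarIntegral, key]
  simp_rw [← Finset.sum_smul, p.sum_toFun, hs, ite_smul, zero_smul, smul_ite, smul_zero,
    Finset.sum_ite_eq', Finset.mem_univ, if_true, smul_smul]
  congr 1
  rw [twist]
  field_simp

/-- Bilinear maps which agree on all pairs of homogeneous vectors are equal. -/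
theorem ext_homogeneous₂ {V W : Type*} [AddCommGroup V] [Module ℂ V] [AddCommMonoid W]
    [Module ℂ W] {β : AddChar H (Module.End ℂ V)} {f g : V →ₗ[ℂ] V →ₗ[ℂ] W}
    (h : ∀ x y v w, p.IsHomogeneous β x v → p.IsHomogeneous β y w → f v w = g v w) : f = g :=
  ext_homogeneous fun x v hv => ext_homogeneous fun y w hw => h x y v w hv hw

variable {m : A →ₗ[ℂ] A →ₗ[ℂ] A}

theorem spectralProj_deformedMul (hα : IsStarAction α)
    (hm : ∀ x y a b, p.IsHomogeneous α x a → p.IsHomogeneous α y b →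
      m a b = (p.twist K x y : ℂ) • (a * b)) (v : H) (a b : A) :
    p.spectralProj α v (m a b) = ∑ w, (p.twist K (v - w) w : ℂ) •
      (p.spectralProj α (v - w) a * p.spectralProj α w b) := by
  classical
  have : m.compr₂ (p.spectralProj α v) = ∑ w, (p.twist K (v - w) w : ℂ) •
      (LinearMap.mul ℂ A).compl₁₂ (p.spectralProj α (v - w)) (p.spectralProj α w) := by
    refine ext_homogeneous₂ (p := p) (β := α) fun x y a b ha hb => ?_
    simp only [LinearMap.compr₂_apply, LinearMap.sum_apply, LinearMap.smul_apply,
      LinearMap.compl₁₂_apply, LinearMap.mul_apply', hm x y a b ha hb, map_smul,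
      (ha.mul hα hb).spectralProj_apply, ha.spectralProj_apply, hb.spectralProj_apply]
    rw [Finset.sum_eq_single y]
    · by_cases h : x + y = v
      · subst h
        simp
      · have h' : x ≠ v - y := fun e => h (by rw [e]; abel)
        simp [h, h']
    · intro w _ hw
      simp [hw.symm]
    · simp
  simpa [LinearMap.sum_apply] using LinearMap.congr_fun₂ this a b

variable (p K α) {ι : Type*} (f : ι ≃ H)

/-- The representation of the algebra `A` with deformed product by matrices over `A`. -/
noncomputable def twistedMatrix : A →ₗ[ℂ] CStarMatrix ι ι A where
  toFun a := CStarMatrix.ofMatrix fun i j =>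
    (p.twist K (f i - f j) (f j) : ℂ) • p.spectralProj α (f i - f j) a
  map_add' a b := by
    ext i j
    simp only [map_add, smul_add]
    rfl
  map_smul' c a := by
    ext i j
    simp only [map_smul, smul_comm _ c, RingHom.id_apply]
    rfl

theorem twistedMatrix_apply (a : A) (i j : ι) : p.twistedMatrix K α f a i j =
    (p.twist K (f i - f j) (f j) : ℂ) • p.spectralProj α (f i - f j) a := rfl

theorem twistedMatrix_injective : Function.Injective (p.twistedMatrix K α f) := by
  rw [← LinearMap.ker_eq_bot, LinearMap.ker_eq_bot']
  intro a ha
  rw [← p.sum_spectralProj α a]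
  refine Finset.sum_eq_zero fun x _ => ?_
  have := congr_fun₂ (congrArg (fun M => CStarMatrix.ofMatrix.symm M) ha) (f.symm x) (f.symm 0)
  change p.twistedMatrix K α f a (f.symm x) (f.symm 0) = 0 at this
  simpa [twistedMatrix_apply, twist_zero_right] using this

variable {p K α}

theorem twistedMatrix_one [DecidableEq ι] (hα : IsStarAction α) :
    p.twistedMatrix K α f 1 = 1 := by
  classical
  ext i j
  rw [twistedMatrix_apply, (isHomogeneous_one hα).spectralProj_apply, CStarMatrix.one_apply]
  by_cases h : i = j
  · simp [h, twist_zero_left]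
  · have h' : 0 ≠ f i - f j := fun e => h (f.injective (sub_eq_zero.mp e.symm))
    simp [h, h']

theorem twistedMatrix_deformedMul [Fintype ι] (hα : IsStarAction α)
    (hm : ∀ x y a b, p.IsHomogeneous α x a → p.IsHomogeneous α y b →
      m a b = (p.twist K x y : ℂ) • (a * b)) (a b : A) :
    p.twistedMatrix K α f (m a b) = p.twistedMatrix K α f a * p.twistedMatrix K α f b := by
  ext i j
  rw [CStarMatrix.mul_apply, twistedMatrix_apply, spectralProj_deformedMul hα hm, Finset.smul_sum]
  refine Fintype.sum_equiv ((Equiv.addRight (f j)).trans f.symm) _ _ fun w => ?_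
  simp only [twistedMatrix_apply, Equiv.trans_apply, Equiv.apply_symm_apply, Equiv.coe_addRight,
    smul_mul_smul_comm, smul_smul, ← Circle.coe_mul, add_sub_cancel_right]
  rw [show f i - (w + f j) = f i - f j - w by abel]
  refine congrArg (fun z : Circle => (z : ℂ) • (_ : A)) ?_
  rw [twist_add_right, ← sub_add_cancel (f i - f j) w, twist_add_left, add_sub_cancel_right]
  ac_rfl

theorem twistedMatrix_star (hα : IsStarAction α) (hK : p.IsSkewSymmetric K) (a : A) :
    p.twistedMatrix K α f (star (p.spectralMultiplier α (fun x => p.twist K x x) a)) =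
      star (p.twistedMatrix K α f a) := by
  classical
  have key : ∀ x, p.spectralProj α x (p.spectralMultiplier α (fun x => p.twist K x x) a) =
      (p.twist K x x : ℂ) • p.spectralProj α x a := fun x => by
    have : p.spectralProj α x ∘ₗ p.spectralMultiplier α (fun x => (p.twist K x x : ℂ)) =
        (p.twist K x x : ℂ) • p.spectralProj α x := by
      refine ext_homogeneous (p := p) (β := α) fun y v hv => ?_
      simp only [LinearMap.comp_apply, LinearMap.smul_apply, hv.spectralMultiplier_apply, map_smul,
        hv.spectralProj_apply]
      split_ifs with h
      · rw [h]
      · simp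
    exact LinearMap.congr_fun this a
  ext i j
  rw [CStarMatrix.star_apply, twistedMatrix_apply, twistedMatrix_apply, star_smul,
    star_spectralProj hα, neg_sub, ← neg_sub (f j), ← star_spectralProj hα, key, star_smul,
    star_spectralProj hα, neg_sub, smul_smul]
  rw [← starRingEnd_apply, ← starRingEnd_apply, ← Circle.coe_inv_eq_conj,
    ← Circle.coe_inv_eq_conj, ← Circle.coe_mul]
  refine congrArg (fun z : Circle => (z : ℂ) • (_ : A)) ?_
  rw [twist_self_inv hK, ← neg_sub (f i) (f j)]
  simp only [twist_neg_left, twist_neg_right, inv_inv]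
  rw [← twist_add_right, add_sub_cancel]

end CStar

end PontryaginPairing

open WithConv

namespace CharacterSubgroup

variable {T : Type v} [AddCommGroup T] {A : Type u} [FiniteQuantumGroup A]
  (ι : CharacterSubgroup T A)

section Convolution

variable (C : Type*) [Ring C] [Algebra ℂ C]

/-- The character `E_t π`, as an element of the convolution algebra of linear maps `A → C`. -/
noncomputable def charConv (t : T) : WithConv (A →ₗ[ℂ] C) :=
  toConv (Algebra.linearMap ℂ C ∘ₗ (ι.toCharacter t : A →ₗ[ℂ] ℂ))

theorem charConv_zero : ι.charConv C 0 = 1 := by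
  refine WithConv.ext (LinearMap.ext fun a => ?_)
  change algebraMap ℂ C (ι.toCharacter 0 a) = algebraMap ℂ C _
  rw [ι.map_zero]

theorem charConv_add (s t : T) : ι.charConv C (s + t) = ι.charConv C s * ι.charConv C t := by
  have key : ∀ X : A ⊗[ℂ] A, algebraMap ℂ C (LinearMap.mul' ℂ ℂ
      (TensorProduct.map (ι.toCharacter s : A →ₗ[ℂ] ℂ) (ι.toCharacter t : A →ₗ[ℂ] ℂ) X)) =
      LinearMap.mul' ℂ C (TensorProduct.map (ι.charConv C s).ofConv (ι.charConv C t).ofConv X) := by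
    intro X
    induction X with
    | zero => simp
    | tmul a b => simp [charConv]
    | add X Y hX hY => simp only [_root_.map_add, hX, hY]
  refine WithConv.ext (LinearMap.ext fun a => ?_)
  change algebraMap ℂ C (ι.toCharacter (s + t) a) = _
  rw [ι.map_add, key]
  rfl

theorem charConv_neg_mul (s : T) : ι.charConv C (-s) * ι.charConv C s = 1 := by
  rw [← charConv_add, neg_add_cancel, charConv_zero]

end Convolution

/-- Left translation, as a linear map. -/
noncomputable def leftTranslationₗ (s : T) : Module.End ℂ A :=
  (TensorProduct.lid ℂ A).toLinearMap ∘ₗ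
    (ι.toCharacter (-s) : A →ₗ[ℂ] ℂ).rTensor A ∘ₗ Coalgebra.comul

/-- Right translation, as a linear map. -/
noncomputable def rightTranslationₗ (s : T) : Module.End ℂ A :=
  (TensorProduct.rid ℂ A).toLinearMap ∘ₗ
    (ι.toCharacter s : A →ₗ[ℂ] ℂ).lTensor A ∘ₗ Coalgebra.comul

section Convolution

variable {C : Type*} [Ring C] [Algebra ℂ C]

theorem comp_leftTranslationₗ (f : A →ₗ[ℂ] C) (s : T) :
    toConv (f ∘ₗ ι.leftTranslationₗ s) = ι.charConv C (-s) * toConv f := by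
  refine WithConv.ext (LinearMap.ext fun a => ?_)
  change f (TensorProduct.lid ℂ A ((ι.toCharacter (-s) : A →ₗ[ℂ] ℂ).rTensor A _)) =
    LinearMap.mul' ℂ C (TensorProduct.map (ι.charConv C (-s)).ofConv f (Coalgebra.comul a))
  induction (Coalgebra.comul (R := ℂ) a) with
  | zero => simp
  | tmul a b => simp [charConv, Algebra.smul_def (A := C)]
  | add X Y hX hY => simp only [_root_.map_add, hX, hY]

theorem comp_rightTranslationₗ (f : A →ₗ[ℂ] C) (s : T) :
    toConv (f ∘ₗ ι.rightTranslationₗ s) = toConv f * ι.charConv C s := by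
  refine WithConv.ext (LinearMap.ext fun a => ?_)
  change f (TensorProduct.rid ℂ A ((ι.toCharacter s : A →ₗ[ℂ] ℂ).lTensor A _)) =
    LinearMap.mul' ℂ C (TensorProduct.map f (ι.charConv C s).ofConv (Coalgebra.comul a))
  induction (Coalgebra.comul (R := ℂ) a) with
  | zero => simp
  | tmul a b => simp [charConv, Algebra.smul_def (A := C), Algebra.commutes]
  | add X Y hX hY => simp only [_root_.map_add, hX, hY]

theorem toConv_leftTranslationₗ (s : T) :
    toConv (ι.leftTranslationₗ s) = ι.charConv A (-s) * toConv LinearMap.id :=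
  ι.comp_leftTranslationₗ LinearMap.id s

theorem toConv_rightTranslationₗ (s : T) :
    toConv (ι.rightTranslationₗ s) = toConv LinearMap.id * ι.charConv A s :=
  ι.comp_rightTranslationₗ LinearMap.id s

end Convolution

/-- The left translations form a representation of `T`. -/
noncomputable def leftRep : AddChar T (Module.End ℂ A) where
  toFun := ι.leftTranslationₗ
  map_zero_eq_one' := toConv_injective (by
    rw [toConv_leftTranslationₗ, neg_zero, charConv_zero, one_mul]; rfl)
  map_add_eq_mul' s t := toConv_injective (by
    rw [Module.End.mul_eq_comp, comp_leftTranslationₗ, toConv_leftTranslationₗ,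
      toConv_leftTranslationₗ, ← mul_assoc, ← charConv_add, neg_add_rev])

/-- The right translations form a representation of `T`. -/
noncomputable def rightRep : AddChar T (Module.End ℂ A) where
  toFun := ι.rightTranslationₗ
  map_zero_eq_one' := toConv_injective (by
    rw [toConv_rightTranslationₗ, charConv_zero, mul_one]; rfl)
  map_add_eq_mul' s t := toConv_injective (by
    rw [Module.End.mul_eq_comp, comp_rightTranslationₗ, toConv_rightTranslationₗ,
      toConv_rightTranslationₗ, mul_assoc, ← charConv_add])

theorem toConv_comp_leftRep {C : Type*} [Ring C] [Algebra ℂ C] (f : A →ₗ[ℂ] C) (s : T) :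
    toConv (f ∘ₗ ι.leftRep s) = ι.charConv C (-s) * toConv f :=
  ι.comp_leftTranslationₗ f s

theorem toConv_comp_rightRep {C : Type*} [Ring C] [Algebra ℂ C] (f : A →ₗ[ℂ] C) (s : T) :
    toConv (f ∘ₗ ι.rightRep s) = toConv f * ι.charConv C s :=
  ι.comp_rightTranslationₗ f s

theorem toConv_leftRep (s : T) :
    toConv (ι.leftRep s) = ι.charConv A (-s) * toConv LinearMap.id :=
  ι.toConv_leftTranslationₗ s

theorem toConv_rightRep (s : T) :
    toConv (ι.rightRep s) = toConv LinearMap.id * ι.charConv A s :=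
  ι.toConv_rightTranslationₗ s

theorem leftRep_comp_rightRep (s t : T) :
    ι.leftRep s ∘ₗ ι.rightRep t = ι.rightRep t ∘ₗ ι.leftRep s := toConv_injective (by
  rw [toConv_comp_leftRep, toConv_comp_rightRep, toConv_leftRep, toConv_rightRep, mul_assoc])

/-- The action of `T ⊕ T` on `A` by translations, as a representation. -/
noncomputable def actionRep : AddChar (T × T) (Module.End ℂ A) where
  toFun x := ι.leftRep x.1 * ι.rightRep x.2
  map_zero_eq_one' := by simp
  map_add_eq_mul' x y := by
    have h : ι.leftRep y.1 * ι.rightRep x.2 = ι.rightRep x.2 * ι.leftRep y.1 :=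
      ι.leftRep_comp_rightRep _ _
    rw [Prod.fst_add, Prod.snd_add, AddChar.map_add_eq_mul, AddChar.map_add_eq_mul, mul_assoc,
      mul_assoc, ← mul_assoc (ι.rightRep x.2), ← h, mul_assoc]

theorem actionRep_apply (x : T × T) (a : A) :
    ι.actionRep x a = ι.leftRep x.1 (ι.rightRep x.2 a) := rfl

theorem isStarAction_leftRep : IsStarAction ι.leftRep where
  map_mul s a b := by
    change TensorProduct.lid ℂ A (LinearMap.rTensor A _ _) =
      TensorProduct.lid ℂ A (LinearMap.rTensor A _ _) *
      TensorProduct.lid ℂ A (LinearMap.rTensor A _ _)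
    rw [FiniteQuantumGroup.comul_mul]
    exact map_mul ((Algebra.TensorProduct.lid ℂ A).toAlgHom.comp
      (Algebra.TensorProduct.map (ι.toCharacter (-s)).toAlgHom (AlgHom.id ℂ A))) _ _
  map_one s := by
    change TensorProduct.lid ℂ A (LinearMap.rTensor A _ _) = _
    rw [FiniteQuantumGroup.comul_one]
    exact map_one ((Algebra.TensorProduct.lid ℂ A).toAlgHom.comp
      (Algebra.TensorProduct.map (ι.toCharacter (-s)).toAlgHom (AlgHom.id ℂ A)))
  map_star s a := by
    change TensorProduct.lid ℂ A (LinearMap.rTensor A _ _) =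
      star (TensorProduct.lid ℂ A (LinearMap.rTensor A _ _))
    rw [FiniteQuantumGroup.comul_star]
    induction (Coalgebra.comul (R := ℂ) a) with
    | zero => simp
    | tmul a b => simp [map_star]
    | add X Y hX hY => simp only [star_add, _root_.map_add, hX, hY]

theorem isStarAction_rightRep : IsStarAction ι.rightRep where
  map_mul s a b := by
    change TensorProduct.rid ℂ A (LinearMap.lTensor A _ _) =
      TensorProduct.rid ℂ A (LinearMap.lTensor A _ _) *
      TensorProduct.rid ℂ A (LinearMap.lTensor A _ _)
    rw [FiniteQuantumGroup.comul_mul]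
    exact map_mul ((Algebra.TensorProduct.rid ℂ ℂ A).toAlgHom.comp
      (Algebra.TensorProduct.map (AlgHom.id ℂ A) (ι.toCharacter s).toAlgHom)) _ _
  map_one s := by
    change TensorProduct.rid ℂ A (LinearMap.lTensor A _ _) = _
    rw [FiniteQuantumGroup.comul_one]
    exact map_one ((Algebra.TensorProduct.rid ℂ ℂ A).toAlgHom.comp
      (Algebra.TensorProduct.map (AlgHom.id ℂ A) (ι.toCharacter s).toAlgHom))
  map_star s a := by
    change TensorProduct.rid ℂ A (LinearMap.lTensor A _ _) =
      star (TensorProduct.rid ℂ A (LinearMap.lTensor A _ _))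
    rw [FiniteQuantumGroup.comul_star]
    induction (Coalgebra.comul (R := ℂ) a) with
    | zero => simp
    | tmul a b => simp [map_star]
    | add X Y hX hY => simp only [star_add, _root_.map_add, hX, hY]

theorem isStarAction_actionRep : IsStarAction ι.actionRep where
  map_mul x a b := by
    simp only [actionRep_apply, ι.isStarAction_rightRep.map_mul, ι.isStarAction_leftRep.map_mul]
  map_one x := by
    simp only [actionRep_apply, ι.isStarAction_rightRep.map_one, ι.isStarAction_leftRep.map_one]
  map_star x a := by
    simp only [actionRep_apply, ι.isStarAction_rightRep.map_star, ι.isStarAction_leftRep.map_star]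

theorem toCharacter_leftRep (t s : T) (a : A) :
    ι.toCharacter t (ι.leftRep s a) = ι.toCharacter (-s + t) a := by
  have := ι.toConv_comp_leftRep (ι.charConv ℂ t).ofConv s
  rw [toConv_ofConv, ← charConv_add] at this
  exact congrArg (fun f => f a) this

theorem toCharacter_rightRep (t s : T) (a : A) :
    ι.toCharacter t (ι.rightRep s a) = ι.toCharacter (t + s) a := by
  have := ι.toConv_comp_rightRep (ι.charConv ℂ t).ofConv s
  rw [toConv_ofConv, ← charConv_add] at this
  exact congrArg (fun f => f a) this

section Comul

/-- The map `a ↦ f a ⊗ 1` in the convolution algebra of linear maps `A → A ⊗ A`. -/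
noncomputable def inclLeft (f : A →ₗ[ℂ] A) : WithConv (A →ₗ[ℂ] A ⊗[ℂ] A) :=
  toConv ((Algebra.TensorProduct.includeLeft : A →ₐ[ℂ] A ⊗[ℂ] A).toLinearMap ∘ₗ f)

/-- The map `a ↦ 1 ⊗ f a` in the convolution algebra of linear maps `A → A ⊗ A`. -/
noncomputable def inclRight (f : A →ₗ[ℂ] A) : WithConv (A →ₗ[ℂ] A ⊗[ℂ] A) :=
  toConv ((Algebra.TensorProduct.includeRight : A →ₐ[ℂ] A ⊗[ℂ] A).toLinearMap ∘ₗ f)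

theorem inclLeft_mul_inclRight (f g : A →ₗ[ℂ] A) :
    inclLeft f * inclRight g = toConv (TensorProduct.map f g ∘ₗ Coalgebra.comul) := by
  refine WithConv.ext (LinearMap.ext fun a => ?_)
  change LinearMap.mul' ℂ _ (TensorProduct.map (inclLeft f).ofConv (inclRight g).ofConv
    (Coalgebra.comul a)) = TensorProduct.map f g (Coalgebra.comul a)
  induction (Coalgebra.comul (R := ℂ) a) with
  | zero => simp
  | tmul a b => simp [inclLeft, inclRight]
  | add X Y hX hY => simp only [_root_.map_add, hX, hY]

theorem inclLeft_mul_inclRight_id : inclLeft LinearMap.id * inclRight LinearMap.id =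
    toConv (Coalgebra.comul : A →ₗ[ℂ] A ⊗[ℂ] A) := by
  rw [inclLeft_mul_inclRight, TensorProduct.map_id, LinearMap.id_comp]

theorem inclLeft_leftRep (s : T) :
    inclLeft (ι.leftRep s) = ι.charConv _ (-s) * inclLeft LinearMap.id :=
  ι.toConv_comp_leftRep _ s

theorem inclLeft_rightRep (s : T) :
    inclLeft (ι.rightRep s) = inclLeft LinearMap.id * ι.charConv _ s :=
  ι.toConv_comp_rightRep _ s

theorem inclRight_leftRep (s : T) :
    inclRight (ι.leftRep s) = ι.charConv _ (-s) * inclRight LinearMap.id :=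
  ι.toConv_comp_leftRep _ s

theorem inclRight_rightRep (s : T) :
    inclRight (ι.rightRep s) = inclRight LinearMap.id * ι.charConv _ s :=
  ι.toConv_comp_rightRep _ s

theorem comul_comp_leftRep (s : T) : Coalgebra.comul ∘ₗ ι.leftRep s =
    (ι.leftRep s).rTensor A ∘ₗ Coalgebra.comul := toConv_injective (by
  rw [toConv_comp_leftRep, ← inclLeft_mul_inclRight_id, ← mul_assoc, ← inclLeft_leftRep,
    inclLeft_mul_inclRight]
  rfl)

theorem comul_comp_rightRep (s : T) : Coalgebra.comul ∘ₗ ι.rightRep s =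
    (ι.rightRep s).lTensor A ∘ₗ Coalgebra.comul := toConv_injective (by
  rw [toConv_comp_rightRep, ← inclLeft_mul_inclRight_id, mul_assoc, ← inclRight_rightRep,
    inclLeft_mul_inclRight]
  rfl)

theorem rTensor_rightRep_comp_comul (s : T) : (ι.rightRep s).rTensor A ∘ₗ Coalgebra.comul =
    (ι.leftRep (-s)).lTensor A ∘ₗ Coalgebra.comul := toConv_injective (by
  rw [LinearMap.rTensor, LinearMap.lTensor, ← inclLeft_mul_inclRight, ← inclLeft_mul_inclRight,
    inclLeft_rightRep, inclRight_leftRep, neg_neg, mul_assoc])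

end Comul

section Antipode

/-- The antipode, as an element of the convolution algebra. -/
noncomputable def antipodeConv (A : Type u) [FiniteQuantumGroup A] : WithConv (A →ₗ[ℂ] A) :=
  toConv FiniteQuantumGroup.antipode

theorem antipodeConv_mul_id : antipodeConv A * toConv LinearMap.id = 1 :=
  WithConv.ext (LinearMap.ext fun a =>
    (FiniteQuantumGroup.mul_antipode_rTensor_comul a).trans (Algebra.algebraMap_eq_smul_one _).symm)

theorem id_mul_antipodeConv : toConv LinearMap.id * antipodeConv A = 1 :=
  WithConv.ext (LinearMap.ext fun a =>
    (FiniteQuantumGroup.mul_antipode_lTensor_comul a).trans (Algebra.algebraMap_eq_smul_one _).symm)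

/-- Composition with a multiplicative unital linear map is multiplicative for convolution. -/
theorem toConv_comp_mul {f : Module.End ℂ A} (hf : ∀ a b, f (a * b) = f a * f b)
    (g h : WithConv (A →ₗ[ℂ] A)) :
    toConv (f ∘ₗ (g * h).ofConv) = toConv (f ∘ₗ g.ofConv) * toConv (f ∘ₗ h.ofConv) := by
  refine WithConv.ext (LinearMap.ext fun a => ?_)
  change f (LinearMap.mul' ℂ A (TensorProduct.map g.ofConv h.ofConv (Coalgebra.comul a))) =
    LinearMap.mul' ℂ A (TensorProduct.map (f ∘ₗ g.ofConv) (f ∘ₗ h.ofConv) (Coalgebra.comul a))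
  induction (Coalgebra.comul (R := ℂ) a) with
  | zero => simp
  | tmul a b => simp [hf]
  | add X Y hX hY => simp only [_root_.map_add, hX, hY]

theorem toConv_comp_one {f : Module.End ℂ A} (hf : f 1 = 1) :
    toConv (f ∘ₗ (1 : WithConv (A →ₗ[ℂ] A)).ofConv) = 1 := by
  refine WithConv.ext (LinearMap.ext fun a => ?_)
  change f (algebraMap ℂ A _) = algebraMap ℂ A _
  rw [Algebra.algebraMap_eq_smul_one, map_smul, hf]

theorem leftRep_comp_antipode (s : T) : ι.leftRep s ∘ₗ FiniteQuantumGroup.antipode =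
    FiniteQuantumGroup.antipode ∘ₗ ι.rightRep s := toConv_injective (by
  refine left_inv_eq_right_inv (a := toConv (ι.leftRep s)) ?_ ?_
  · have := toConv_comp_mul (ι.isStarAction_leftRep.map_mul s) (antipodeConv A)
      (toConv LinearMap.id)
    rw [antipodeConv_mul_id, toConv_comp_one (ι.isStarAction_leftRep.map_one s)] at this
    exact this.symm
  · rw [toConv_comp_rightRep, toConv_leftRep]
    change _ * (antipodeConv A * _) = _
    rw [mul_assoc, ← mul_assoc (toConv LinearMap.id), id_mul_antipodeConv, one_mul,
      charConv_neg_mul])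

theorem rightRep_comp_antipode (s : T) : ι.rightRep s ∘ₗ FiniteQuantumGroup.antipode =
    FiniteQuantumGroup.antipode ∘ₗ ι.leftRep s := toConv_injective (by
  refine (left_inv_eq_right_inv (a := toConv (ι.rightRep s)) ?_ ?_).symm
  · rw [toConv_comp_leftRep, toConv_rightRep]
    change _ * antipodeConv A * _ = _
    rw [mul_assoc, ← mul_assoc (antipodeConv A), antipodeConv_mul_id, one_mul,
      charConv_neg_mul]
  · have := toConv_comp_mul (ι.isStarAction_rightRep.map_mul s) (toConv LinearMap.id)
      (antipodeConv A)
    rw [id_mul_antipodeConv, toConv_comp_one (ι.isStarAction_rightRep.map_one s)] at this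
    exact this.symm)

end Antipode

end CharacterSubgroup

/-- The coalgebra structure transported along a linear isomorphism. -/
@[reducible] noncomputable def LinearEquiv.transportCoalgebra {A B : Type*} [AddCommGroup A]
    [Module ℂ A] [Coalgebra ℂ A] [AddCommGroup B] [Module ℂ B] (e : A ≃ₗ[ℂ] B) :
    Coalgebra ℂ B where
  comul := TensorProduct.map (e : A →ₗ[ℂ] B) (e : A →ₗ[ℂ] B) ∘ₗ Coalgebra.comul ∘ₗ
    (e.symm : B →ₗ[ℂ] A)
  counit := Coalgebra.counit ∘ₗ (e.symm : B →ₗ[ℂ] A)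
  coassoc := by
    have h := Coalgebra.coassoc (R := ℂ) (A := A)
    ext b
    have h' := LinearMap.congr_fun h (e.symm b)
    simp only [LinearMap.comp_apply, LinearEquiv.coe_coe] at h' ⊢
    have hl : ∀ X : A ⊗[ℂ] A, LinearMap.rTensor B (TensorProduct.map (e : A →ₗ[ℂ] B)
        (e : A →ₗ[ℂ] B) ∘ₗ Coalgebra.comul ∘ₗ (e.symm : B →ₗ[ℂ] A))
        (TensorProduct.map (e : A →ₗ[ℂ] B) (e : A →ₗ[ℂ] B) X) =
        TensorProduct.map (TensorProduct.map (e : A →ₗ[ℂ] B) (e : A →ₗ[ℂ] B)) (e : A →ₗ[ℂ] B)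
          (LinearMap.rTensor A Coalgebra.comul X) := fun X => by
      induction X with
      | zero => simp
      | tmul a b => simp
      | add X Y hX hY => simp only [map_add, hX, hY]
    have hr : ∀ X : A ⊗[ℂ] A, LinearMap.lTensor B (TensorProduct.map (e : A →ₗ[ℂ] B)
        (e : A →ₗ[ℂ] B) ∘ₗ Coalgebra.comul ∘ₗ (e.symm : B →ₗ[ℂ] A))
        (TensorProduct.map (e : A →ₗ[ℂ] B) (e : A →ₗ[ℂ] B) X) =
        TensorProduct.map (e : A →ₗ[ℂ] B) (TensorProduct.map (e : A →ₗ[ℂ] B) (e : A →ₗ[ℂ] B))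
          (LinearMap.lTensor A Coalgebra.comul X) := fun X => by
      induction X with
      | zero => simp
      | tmul a b => simp
      | add X Y hX hY => simp only [map_add, hX, hY]
    rw [hl, hr, ← TensorProduct.map_map_assoc, h']
  rTensor_counit_comp_comul := by
    ext b
    have h := LinearMap.congr_fun (Coalgebra.rTensor_counit_comp_comul (R := ℂ) (A := A))
      (e.symm b)
    simp only [LinearMap.comp_apply, LinearEquiv.coe_coe] at h ⊢
    have hl : ∀ X : A ⊗[ℂ] A, LinearMap.rTensor B (Coalgebra.counit ∘ₗ (e.symm : B →ₗ[ℂ] A))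
        (TensorProduct.map (e : A →ₗ[ℂ] B) (e : A →ₗ[ℂ] B) X) =
        LinearMap.lTensor ℂ (e : A →ₗ[ℂ] B) (LinearMap.rTensor A Coalgebra.counit X) := fun X => by
      induction X with
      | zero => simp
      | tmul a b => simp
      | add X Y hX hY => simp only [map_add, hX, hY]
    rw [hl, h]
    simp
  lTensor_counit_comp_comul := by
    ext b
    have h := LinearMap.congr_fun (Coalgebra.lTensor_counit_comp_comul (R := ℂ) (A := A))
      (e.symm b)
    simp only [LinearMap.comp_apply, LinearEquiv.coe_coe] at h ⊢
    have hl : ∀ X : A ⊗[ℂ] A, LinearMap.lTensor B (Coalgebra.counit ∘ₗ (e.symm : B →ₗ[ℂ] A))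
        (TensorProduct.map (e : A →ₗ[ℂ] B) (e : A →ₗ[ℂ] B) X) =
        LinearMap.rTensor ℂ (e : A →ₗ[ℂ] B) (LinearMap.lTensor A Coalgebra.counit X) := fun X => by
      induction X with
      | zero => simp
      | tmul a b => simp
      | add X Y hX hY => simp only [map_add, hX, hY]
    rw [hl, h]
    simp

namespace CharacterSubgroup

variable {T : Type v} [AddCommGroup T] {A : Type u} [FiniteQuantumGroup A]
  (ι : CharacterSubgroup T A)

/-- The algebraic conditions on a bilinear product `m`, an operator `Q` and a linear map `κ` on `A`
under which `m`, the involution `a ↦ (Q a)*` and the antipode `κ` are compatible with the coproduct,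
counit and characters of `A`. -/
structure IsDeformation (m : A →ₗ[ℂ] A →ₗ[ℂ] A) (Q κ : Module.End ℂ A) : Prop where
  comul_mul : ∀ a b, Coalgebra.comul (R := ℂ) (m a b) =
    TensorProduct.map₂ m m (Coalgebra.comul a) (Coalgebra.comul b)
  comul_sign : ∀ a, Coalgebra.comul (R := ℂ) (Q a) = TensorProduct.map Q Q (Coalgebra.comul a)
  toCharacter_mul : ∀ t a b, ι.toCharacter t (m a b) = ι.toCharacter t a * ι.toCharacter t b
  toCharacter_sign : ∀ t a, ι.toCharacter t (Q a) = ι.toCharacter t a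
  antipode_mul : ∀ a b, κ (m a b) = m (κ b) (κ a)
  antipode_star : ∀ a, κ (star (Q a)) = star (Q (κ a))
  antipode_antipode : ∀ a, κ (κ a) = a
  lift_antipode_rTensor : ∀ a, TensorProduct.lift m (κ.rTensor A (Coalgebra.comul a)) =
    (Coalgebra.counit a : ℂ) • (1 : A)
  lift_antipode_lTensor : ∀ a, TensorProduct.lift m (κ.lTensor A (Coalgebra.comul a)) =
    (Coalgebra.counit a : ℂ) • (1 : A)

variable {ι} {m : A →ₗ[ℂ] A →ₗ[ℂ] A} {Q κ : Module.End ℂ A}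

theorem IsDeformation.counit_mul (h : ι.IsDeformation m Q κ) (a b : A) :
    Coalgebra.counit (R := ℂ) (m a b) =
      Coalgebra.counit (R := ℂ) a * Coalgebra.counit (R := ℂ) b := by
  simp only [← ι.map_zero, h.toCharacter_mul]

theorem IsDeformation.counit_star (h : ι.IsDeformation m Q κ) (a : A) :
    Coalgebra.counit (R := ℂ) (star (Q a)) = star (Coalgebra.counit (R := ℂ) a) := by
  simp only [← ι.map_zero, map_star, h.toCharacter_sign]

section Realization

variable {B : Type u} [CStarAlgebra B] (e : A ≃ₗ[ℂ] B)

/-- The linear isomorphism `e` carries the product `m`, the unit of `A` and the involution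
`a ↦ (Q a)*` to the structure of the C*-algebra `B`. -/
structure IsRealization (m : A →ₗ[ℂ] A →ₗ[ℂ] A) (Q : Module.End ℂ A) : Prop where
  map_mul : ∀ a b, e (m a b) = e a * e b
  map_one : e 1 = 1
  map_star : ∀ a, e (star (Q a)) = star (e a)

variable {e}

theorem IsRealization.symm_mul (he : IsRealization e m Q) (a b : B) :
    e.symm (a * b) = m (e.symm a) (e.symm b) := by
  rw [LinearEquiv.symm_apply_eq, he.map_mul, e.apply_symm_apply, e.apply_symm_apply]

theorem IsRealization.symm_one (he : IsRealization e m Q) : e.symm 1 = 1 := by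
  rw [LinearEquiv.symm_apply_eq, he.map_one]

theorem IsRealization.symm_star (he : IsRealization e m Q) (a : B) :
    e.symm (star a) = star (Q (e.symm a)) := by
  rw [LinearEquiv.symm_apply_eq, he.map_star, e.apply_symm_apply]

theorem IsRealization.map_map₂ (he : IsRealization e m Q) (X Y : A ⊗[ℂ] A) :
    TensorProduct.map (e : A →ₗ[ℂ] B) (e : A →ₗ[ℂ] B) (TensorProduct.map₂ m m X Y) =
      TensorProduct.map (e : A →ₗ[ℂ] B) (e : A →ₗ[ℂ] B) X *
        TensorProduct.map (e : A →ₗ[ℂ] B) (e : A →ₗ[ℂ] B) Y := by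
  induction X with
  | zero => simp
  | add X X' hX hX' => simp only [_root_.map_add, LinearMap.add_apply, hX, hX', add_mul]
  | tmul a b =>
    induction Y with
    | zero => simp
    | add Y Y' hY hY' => simp only [_root_.map_add, hY, hY', mul_add]
    | tmul c d => simp [he.map_mul]

theorem IsRealization.map_star_map (he : IsRealization e m Q) (X : A ⊗[ℂ] A) :
    TensorProduct.map (e : A →ₗ[ℂ] B) (e : A →ₗ[ℂ] B) (star (TensorProduct.map Q Q X)) =
      star (TensorProduct.map (e : A →ₗ[ℂ] B) (e : A →ₗ[ℂ] B) X) := by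
  induction X with
  | zero => simp
  | add X Y hX hY => simp only [_root_.map_add, star_add, hX, hY]
  | tmul a b => simp [he.map_star]

theorem IsRealization.mul'_map (he : IsRealization e m Q) (X : A ⊗[ℂ] A) :
    LinearMap.mul' ℂ B (TensorProduct.map (e : A →ₗ[ℂ] B) (e : A →ₗ[ℂ] B) X) =
      e (TensorProduct.lift m X) := by
  induction X with
  | zero => simp
  | add X Y hX hY => simp only [_root_.map_add, hX, hY]
  | tmul a b => simp [he.map_mul]

variable (e κ) in
/-- The linear map `κ`, transported along `e`. -/
noncomputable def conjMap : B →ₗ[ℂ] B := (e : A →ₗ[ℂ] B) ∘ₗ κ ∘ₗ (e.symm : B →ₗ[ℂ] A)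

variable (e κ) in
theorem conjMap_apply (a : A) : conjMap κ e (e a) = e (κ a) := by simp [conjMap]

theorem rTensor_conjMap (X : A ⊗[ℂ] A) :
    (conjMap κ e).rTensor B (TensorProduct.map (e : A →ₗ[ℂ] B) (e : A →ₗ[ℂ] B) X) =
      TensorProduct.map (e : A →ₗ[ℂ] B) (e : A →ₗ[ℂ] B) (κ.rTensor A X) := by
  induction X with
  | zero => simp
  | add X Y hX hY => simp only [_root_.map_add, hX, hY]
  | tmul a b => simp [conjMap_apply]

theorem lTensor_conjMap (X : A ⊗[ℂ] A) :
    (conjMap κ e).lTensor B (TensorProduct.map (e : A →ₗ[ℂ] B) (e : A →ₗ[ℂ] B) X) =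
      TensorProduct.map (e : A →ₗ[ℂ] B) (e : A →ₗ[ℂ] B) (κ.lTensor A X) := by
  induction X with
  | zero => simp
  | add X Y hX hY => simp only [_root_.map_add, hX, hY]
  | tmul a b => simp [conjMap_apply]

variable (e) in
theorem transport_comul (a : A) : e.transportCoalgebra.comul (e a) =
    TensorProduct.map (e : A →ₗ[ℂ] B) (e : A →ₗ[ℂ] B) (Coalgebra.comul a) :=
  congrArg (fun x => TensorProduct.map (e : A →ₗ[ℂ] B) (e : A →ₗ[ℂ] B) (Coalgebra.comul x))
    (e.symm_apply_apply a)

variable (e) in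
theorem transport_counit (a : A) :
    e.transportCoalgebra.counit (e a) = Coalgebra.counit (R := ℂ) a :=
  congrArg (fun x => Coalgebra.counit (R := ℂ) x) (e.symm_apply_apply a)

/-- The quantum group structure on `B` obtained by transport of the deformed structure of `A`. -/
@[reducible] noncomputable def IsDeformation.quantumGroup (h : ι.IsDeformation m Q κ)
    (he : IsRealization e m Q) : FiniteQuantumGroup B where
  toCStarAlgebra := inferInstance
  toCoalgebra := e.transportCoalgebra
  finiteDimensional :=
    have := FiniteQuantumGroup.finiteDimensional (A := A)
    Module.Finite.equiv e
  comul_one := by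
    rw [← he.map_one, transport_comul, FiniteQuantumGroup.comul_one,
      Algebra.TensorProduct.one_def, TensorProduct.map_tmul, LinearEquiv.coe_coe, he.map_one,
      Algebra.TensorProduct.one_def]
  comul_mul a b := by
    obtain ⟨a, rfl⟩ := e.surjective a
    obtain ⟨b, rfl⟩ := e.surjective b
    rw [← he.map_mul, transport_comul, transport_comul, transport_comul, h.comul_mul, he.map_map₂]
  comul_star a := by
    obtain ⟨a, rfl⟩ := e.surjective a
    rw [← he.map_star, transport_comul, transport_comul, FiniteQuantumGroup.comul_star,
      h.comul_sign, he.map_star_map]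
  counit_one := by
    rw [← he.map_one, transport_counit, FiniteQuantumGroup.counit_one]
  counit_mul a b := by
    obtain ⟨a, rfl⟩ := e.surjective a
    obtain ⟨b, rfl⟩ := e.surjective b
    rw [← he.map_mul, transport_counit, transport_counit, transport_counit, h.counit_mul]
  counit_star a := by
    obtain ⟨a, rfl⟩ := e.surjective a
    rw [← he.map_star, transport_counit, transport_counit, h.counit_star]
  antipode := conjMap κ e
  antipode_mul a b := by
    obtain ⟨a, rfl⟩ := e.surjective a
    obtain ⟨b, rfl⟩ := e.surjective b
    rw [← he.map_mul, conjMap_apply, conjMap_apply, conjMap_apply, h.antipode_mul, he.map_mul]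
  antipode_star a := by
    obtain ⟨a, rfl⟩ := e.surjective a
    rw [← he.map_star, conjMap_apply, conjMap_apply, h.antipode_star, he.map_star]
  antipode_antipode a := by
    obtain ⟨a, rfl⟩ := e.surjective a
    rw [conjMap_apply, conjMap_apply, h.antipode_antipode]
  mul_antipode_rTensor_comul a := by
    obtain ⟨a, rfl⟩ := e.surjective a
    rw [transport_comul, transport_counit, rTensor_conjMap, he.mul'_map, h.lift_antipode_rTensor,
      map_smul, he.map_one]
  mul_antipode_lTensor_comul a := by
    obtain ⟨a, rfl⟩ := e.surjective a
    rw [transport_comul, transport_counit, lTensor_conjMap, he.mul'_map, h.lift_antipode_lTensor,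
      map_smul, he.map_one]

/-- The character `E_t π`, transported to the deformed quantum group. -/
noncomputable def IsDeformation.character (h : ι.IsDeformation m Q κ)
    (he : IsRealization e m Q) (t : T) : B →⋆ₐ[ℂ] ℂ where
  toAlgHom := AlgHom.ofLinearMap ((ι.toCharacter t : A →ₗ[ℂ] ℂ) ∘ₗ (e.symm : B →ₗ[ℂ] A))
    (by simp [he.symm_one]) (fun a b => by simp [he.symm_mul, h.toCharacter_mul])
  map_star' a := by
    change ι.toCharacter t (e.symm (star a)) = star (ι.toCharacter t (e.symm a))
    rw [he.symm_star, map_star, h.toCharacter_sign]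

theorem IsDeformation.character_apply (h : ι.IsDeformation m Q κ)
    (he : IsRealization e m Q) (t : T) (a : A) :
    h.character he t (e a) = ι.toCharacter t a :=
  congrArg (ι.toCharacter t) (e.symm_apply_apply a)

/-- The group `T` as a subgroup of the deformed quantum group. -/
noncomputable def IsDeformation.characterSubgroup (h : ι.IsDeformation m Q κ)
    (he : IsRealization e m Q) : @CharacterSubgroup T _ B (h.quantumGroup he) :=
  letI := h.quantumGroup he
  { toCharacter := h.character he
    injective := fun s t hst => ι.injective (DFunLike.ext _ _ fun a => by
      rw [← h.character_apply he, hst, h.character_apply he])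
    map_zero := fun a => by
      obtain ⟨a, rfl⟩ := e.surjective a
      exact (h.character_apply he 0 a).trans ((ι.map_zero a).trans (transport_counit e a).symm)
    map_add := fun s t a => by
      obtain ⟨a, rfl⟩ := e.surjective a
      have key : ∀ X : A ⊗[ℂ] A, TensorProduct.map (h.character he s : B →ₗ[ℂ] ℂ)
          (h.character he t : B →ₗ[ℂ] ℂ)
          (TensorProduct.map (e : A →ₗ[ℂ] B) (e : A →ₗ[ℂ] B) X) =
          TensorProduct.map (ι.toCharacter s : A →ₗ[ℂ] ℂ) (ι.toCharacter t : A →ₗ[ℂ] ℂ) X :=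
        fun X => by
          induction X with
          | zero => simp
          | add X Y hX hY => simp only [_root_.map_add, hX, hY]
          | tmul a b => simp [h.character_apply he]
      refine (h.character_apply he (s + t) a).trans ((ι.map_add s t a).trans ?_)
      rw [← key, ← transport_comul e a] }

theorem IsDeformation.deformsTo_of_isRealization (h : ι.IsDeformation m Q κ)
    (he : IsRealization e m Q) :
    ι.DeformsTo (fun a b => m a b) (fun a => star (Q a)) κ :=
  ⟨B, h.quantumGroup he, e, h.characterSubgroup he, he.map_mul, he.map_one, he.map_star,
    transport_comul e, transport_counit e, conjMap_apply κ e, h.character_apply he⟩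

end Realization

theorem IsDeformation.deformsTo (h : ι.IsDeformation m Q κ) {C : Type u} [CStarAlgebra C]
    {M : A →ₗ[ℂ] C} (hM : Function.Injective M) (hM_mul : ∀ a b, M (m a b) = M a * M b)
    (hM_one : M 1 = 1) (hM_star : ∀ a, M (star (Q a)) = star (M a)) :
    ι.DeformsTo (fun a b => m a b) (fun a => star (Q a)) κ := by
  let B : StarSubalgebra ℂ C :=
    { carrier := Set.range M
      mul_mem' := by
        rintro _ _ ⟨a, rfl⟩ ⟨b, rfl⟩
        exact ⟨m a b, hM_mul a b⟩
      add_mem' := by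
        rintro _ _ ⟨a, rfl⟩ ⟨b, rfl⟩
        exact ⟨a + b, _root_.map_add M a b⟩
      algebraMap_mem' := fun c => ⟨c • 1, by
        rw [map_smul, hM_one, Algebra.algebraMap_eq_smul_one]⟩
      star_mem' := by
        rintro _ ⟨a, rfl⟩
        exact ⟨_, hM_star a⟩ }
  have := FiniteQuantumGroup.finiteDimensional (A := A)
  have : IsClosed (B : Set C) := (LinearMap.range M).closed_of_finiteDimensional
  let e : A ≃ₗ[ℂ] B := LinearEquiv.ofBijective
    { toFun := fun a => (⟨M a, a, rfl⟩ : B)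
      map_add' := fun a b => Subtype.ext (_root_.map_add M a b)
      map_smul' := fun c a => Subtype.ext (map_smul M c a) }
    ⟨fun a b hab => hM (congrArg Subtype.val hab), fun ⟨_, a, ha⟩ => ⟨a, Subtype.ext ha⟩⟩
  exact h.deformsTo_of_isRealization (e := e)
    ⟨fun a b => Subtype.ext (hM_mul a b), Subtype.ext hM_one, fun a => Subtype.ext (hM_star a)⟩

end CharacterSubgroup

namespace LinearMap

variable {R M N P ι : Type*} [CommSemiring R] [AddCommMonoid M] [Module R M] [AddCommMonoid N]
  [Module R N] [AddCommMonoid P] [Module R P]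

theorem rTensor_sum (s : Finset ι) (f : ι → N →ₗ[R] P) :
    (∑ i ∈ s, f i).rTensor M = ∑ i ∈ s, (f i).rTensor M :=
  map_sum (rTensorHom M) f s

theorem lTensor_sum (s : Finset ι) (f : ι → N →ₗ[R] P) :
    (∑ i ∈ s, f i).lTensor M = ∑ i ∈ s, (f i).lTensor M :=
  map_sum (lTensorHom M) f s

end LinearMap

namespace PontryaginPairing

variable {T : Type v} [AddCommGroup T] {p : PontryaginPairing T}

theorem IsSkewSymmetric.symm {S : T ≃+ T} (hS : p.IsSkewSymmetric S.toAddMonoidHom) :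
    p.IsSkewSymmetric S.symm.toAddMonoidHom := fun s t => by
  have := hS (S.symm s) (S.symm t)
  simp only [AddEquiv.coe_toAddMonoidHom, AddEquiv.apply_symm_apply] at this ⊢
  rw [p.toFun_neg_right, this, p.toFun_neg_right, inv_inv]

theorem IsSkewSymmetric.prodMap_neg {K : T →+ T} (hK : p.IsSkewSymmetric K) :
    p.prod.IsSkewSymmetric (K.prodMap (-K)) := fun s t => by
  change p.toFun (K s.1) t.1 * p.toFun (-K s.2) t.2 =
    p.toFun s.1 (-K t.1) * p.toFun s.2 (- -K t.2)
  rw [p.toFun_neg_left, hK, hK, p.toFun_neg_right s.2 (-K t.2)]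

theorem twist_prodMap_neg (K : T →+ T) (x y : T × T) :
    p.prod.twist (K.prodMap (-K)) x y = p.twist K x.1 y.1 * (p.twist K x.2 y.2)⁻¹ := by
  change p.toFun (-K y.1) x.1 * p.toFun (- -K y.2) x.2 = _
  rw [p.toFun_neg_left (-K y.2)]
  rfl

section Multiplier

variable {H : Type v} [AddCommGroup H] [Fintype H] {q : PontryaginPairing H} {A : Type u} [Ring A]
  [StarRing A] [Algebra ℂ A] [StarModule ℂ A] {α : AddChar H (Module.End ℂ A)}

theorem spectralMultiplier_star (hα : IsStarAction α) {c : H → ℂ}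
    (hc : ∀ x, c (-x) = star (c x)) (a : A) :
    q.spectralMultiplier α c (star a) = star (q.spectralMultiplier α c a) := by
  simp only [spectralMultiplier, LinearMap.sum_apply, LinearMap.smul_apply, star_sum, star_smul,
    star_spectralProj hα, ← hc]
  exact Fintype.sum_equiv (Equiv.neg H) _ _ fun x => by simp

end Multiplier

end PontryaginPairing

namespace CharacterSubgroup

open PontryaginPairing

variable {T : Type v} [AddCommGroup T] {A : Type u} [FiniteQuantumGroup A]
  {ι : CharacterSubgroup T A} {p : PontryaginPairing T}

theorem isHomogeneous_leftRep {x : T × T} {a : A} (ha : p.prod.IsHomogeneous ι.actionRep x a) :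
    p.IsHomogeneous ι.leftRep x.1 a := fun s => by
  have := ha (s, 0)
  rw [actionRep_apply, AddChar.map_zero_eq_one, Module.End.one_apply] at this
  rw [this]
  change ((p.toFun s x.1 * p.toFun 0 x.2 : Circle) : ℂ) • a = _
  rw [p.toFun_zero_left, mul_one]

theorem isHomogeneous_rightRep {x : T × T} {a : A} (ha : p.prod.IsHomogeneous ι.actionRep x a) :
    p.IsHomogeneous ι.rightRep x.2 a := fun s => by
  have := ha (0, s)
  rw [actionRep_apply, AddChar.map_zero_eq_one, Module.End.one_apply] at this
  rw [this]
  change ((p.toFun 0 x.1 * p.toFun s x.2 : Circle) : ℂ) • a = _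
  rw [p.toFun_zero_left, one_mul]

theorem isHomogeneous_actionRep {x : T × T} {a : A} (hl : p.IsHomogeneous ι.leftRep x.1 a)
    (hr : p.IsHomogeneous ι.rightRep x.2 a) : p.prod.IsHomogeneous ι.actionRep x a := fun s => by
  rw [actionRep_apply, hr s.2, LinearMap.map_smul, hl s.1, smul_smul, ← Circle.coe_mul, mul_comm]
  rfl

theorem isHomogeneous_antipode {x : T × T} {a : A} (ha : p.prod.IsHomogeneous ι.actionRep x a) :
    p.prod.IsHomogeneous ι.actionRep x.swap (FiniteQuantumGroup.antipode a) := by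
  refine isHomogeneous_actionRep (fun s => ?_) fun s => ?_
  · refine (LinearMap.congr_fun (ι.leftRep_comp_antipode s) a).trans ?_
    rw [LinearMap.comp_apply, isHomogeneous_rightRep ha s, LinearMap.map_smul]
    rfl
  · refine (LinearMap.congr_fun (ι.rightRep_comp_antipode s) a).trans ?_
    rw [LinearMap.comp_apply, isHomogeneous_leftRep ha s, LinearMap.map_smul]
    rfl

/-- The characters in `T` vanish on the homogeneous elements outside the antidiagonal. -/
theorem toCharacter_eq_zero {x : T × T} {a : A} (ha : p.prod.IsHomogeneous ι.actionRep x a)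
    (hx : x.1 ≠ -x.2) (t : T) : ι.toCharacter t a = 0 := by
  refine eq_zero_of_smul_eq_smul (p := p) hx fun s => ?_
  have hl := ι.toCharacter_leftRep t s a
  have hr := ι.toCharacter_rightRep t (-s) a
  rw [isHomogeneous_leftRep ha s, map_smul] at hl
  rw [isHomogeneous_rightRep ha (-s), map_smul] at hr
  rw [hl, p.toFun_neg_right, ← p.toFun_neg_left, hr, add_comm]

variable [Fintype T]

theorem spectralProj_leftRep_rightRep (x y : T) (a : A) :
    p.spectralProj ι.leftRep x (p.spectralProj ι.rightRep y a) =
      p.spectralProj ι.rightRep y (p.spectralProj ι.leftRep x a) := by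
  have h : Commute (p.spectralProj ι.leftRep x) (p.spectralProj ι.rightRep y) :=
    ((Commute.sum_left _ _ _ fun s _ => (Commute.sum_right _ _ _ fun t _ =>
      ((show Commute _ _ from ι.leftRep_comp_rightRep s t).smul_right _)).smul_left
        _).smul_left _).smul_right _
  exact LinearMap.congr_fun h a

theorem isHomogeneous_spectralProj_comp (x : T × T) (a : A) :
    p.prod.IsHomogeneous ι.actionRep x
      (p.spectralProj ι.leftRep x.1 (p.spectralProj ι.rightRep x.2 a)) := by
  refine isHomogeneous_actionRep (p.isHomogeneous_spectralProj _ _ _) ?_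
  rw [spectralProj_leftRep_rightRep]
  exact p.isHomogeneous_spectralProj _ _ _

theorem map_spectralProj_comul (a : A) (x : T × T) :
    TensorProduct.map (p.spectralProj ι.leftRep x.1) (p.spectralProj ι.rightRep x.2)
      (Coalgebra.comul a) =
      Coalgebra.comul (p.spectralProj ι.leftRep x.1 (p.spectralProj ι.rightRep x.2 a)) := by
  have hl : ∀ b, Coalgebra.comul (p.spectralProj ι.leftRep x.1 b) =
      (p.spectralProj ι.leftRep x.1).rTensor A (Coalgebra.comul b) := fun b => by
    simp only [spectralProj, LinearMap.smul_apply, LinearMap.sum_apply, map_smul, _root_.map_sum,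
      LinearMap.rTensor_smul, LinearMap.rTensor_sum]
    congr 1
    exact Finset.sum_congr rfl fun t _ =>
      congrArg _ (LinearMap.congr_fun (ι.comul_comp_leftRep t) b)
  have hr : ∀ b, Coalgebra.comul (p.spectralProj ι.rightRep x.2 b) =
      (p.spectralProj ι.rightRep x.2).lTensor A (Coalgebra.comul b) := fun b => by
    simp only [spectralProj, LinearMap.smul_apply, LinearMap.sum_apply, map_smul, _root_.map_sum,
      LinearMap.lTensor_smul, LinearMap.lTensor_sum]
    congr 1
    exact Finset.sum_congr rfl fun t _ =>
      congrArg _ (LinearMap.congr_fun (ι.comul_comp_rightRep t) b)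
  rw [hl, hr, ← LinearMap.rTensor_comp_lTensor, LinearMap.comp_apply]

theorem rTensor_spectralProj_comul (a : A) (y : T) :
    (p.spectralProj ι.rightRep y).rTensor A (Coalgebra.comul a) =
      (p.spectralProj ι.leftRep (-y)).lTensor A (Coalgebra.comul a) := by
  simp only [spectralProj, LinearMap.rTensor_smul, LinearMap.rTensor_sum, LinearMap.lTensor_smul,
    LinearMap.lTensor_sum, LinearMap.smul_apply, LinearMap.sum_apply]
  congr 1
  refine Fintype.sum_equiv (Equiv.neg T) _ _ fun t => ?_
  rw [Equiv.neg_apply, p.toFun_neg_left, p.toFun_neg_left (-t), p.toFun_neg_right,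
    p.toFun_neg_left, inv_inv]
  exact congrArg _ (LinearMap.congr_fun (ι.rTensor_rightRep_comp_comul t) a)

theorem sum_map_spectralProj_comul (a : A) :
    ∑ y, TensorProduct.map (p.spectralProj ι.rightRep y) (p.spectralProj ι.leftRep (-y))
      (Coalgebra.comul a) = Coalgebra.comul a := by
  classical
  have h : ∀ y, TensorProduct.map (p.spectralProj ι.rightRep y) (p.spectralProj ι.leftRep (-y))
      (Coalgebra.comul a) = (p.spectralProj ι.rightRep y).rTensor A (Coalgebra.comul a) :=
      fun y => by
    rw [← LinearMap.rTensor_comp_lTensor, LinearMap.comp_apply, ← rTensor_spectralProj_comul,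
      ← LinearMap.comp_apply, ← LinearMap.rTensor_comp]
    congr 2
    ext b
    rw [LinearMap.comp_apply, (p.isHomogeneous_spectralProj _ _ _).spectralProj_apply, if_pos rfl]
  simp_rw [h]
  rw [← LinearMap.sum_apply, ← LinearMap.rTensor_sum]
  rw [show ∑ y, p.spectralProj ι.rightRep y = LinearMap.id from
    LinearMap.ext fun b => by
      rw [LinearMap.sum_apply, p.sum_spectralProj, LinearMap.id_apply]]
  simp

/-- Linear maps on `A ⊗ A` agree on the coproduct of an element of degree `(x₁, x₂)` as soon as
they agree on the tensor products of elements of degrees `(x₁, y)` and `(-y, x₂)`. -/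
theorem comul_congr {W : Type*} [AddCommGroup W] [Module ℂ W] {x : T × T} {a : A}
    (ha : p.prod.IsHomogeneous ι.actionRep x a) {F G : A ⊗[ℂ] A →ₗ[ℂ] W}
    (h : ∀ y u v, p.prod.IsHomogeneous ι.actionRep (x.1, y) u →
      p.prod.IsHomogeneous ι.actionRep (-y, x.2) v → F (u ⊗ₜ v) = G (u ⊗ₜ v)) :
    F (Coalgebra.comul a) = G (Coalgebra.comul a) := by
  classical
  have key : ∀ y (X : A ⊗[ℂ] A), F (TensorProduct.map (p.spectralProj ι.rightRep y)
        (p.spectralProj ι.leftRep (-y)) (TensorProduct.map (p.spectralProj ι.leftRep x.1)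
        (p.spectralProj ι.rightRep x.2) X)) =
      G (TensorProduct.map (p.spectralProj ι.rightRep y)
        (p.spectralProj ι.leftRep (-y)) (TensorProduct.map (p.spectralProj ι.leftRep x.1)
        (p.spectralProj ι.rightRep x.2) X)) := fun y X => by
    induction X with
    | zero => simp
    | add X Y hX hY => simp only [_root_.map_add, hX, hY]
    | tmul b c =>
      rw [TensorProduct.map_tmul, TensorProduct.map_tmul]
      refine h y _ _ ?_ (isHomogeneous_spectralProj_comp (-y, x.2) c)
      rw [← spectralProj_leftRep_rightRep]
      exact isHomogeneous_spectralProj_comp (x.1, y) b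
  have hax : Coalgebra.comul (R := ℂ) a = TensorProduct.map (p.spectralProj ι.leftRep x.1)
      (p.spectralProj ι.rightRep x.2) (Coalgebra.comul a) := by
    rw [map_spectralProj_comul, (isHomogeneous_rightRep ha).spectralProj_apply, if_pos rfl,
      (isHomogeneous_leftRep ha).spectralProj_apply, if_pos rfl]
  rw [← sum_map_spectralProj_comul (p := p) (ι := ι) a, _root_.map_sum, _root_.map_sum]
  rw [hax]
  exact Finset.sum_congr rfl fun y _ => key y _

end CharacterSubgroup

namespace CharacterSubgroup

open PontryaginPairing

variable {T : Type v} [AddCommGroup T] {A : Type u} [FiniteQuantumGroup A]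
  {ι : CharacterSubgroup T A} {p : PontryaginPairing T} [Fintype T] {K : T →+ T}

variable (ι p K) in
/-- The operator which multiplies the elements of degree `x` by the sign `σ(x, x)` of the twist. -/
noncomputable def signMap : Module.End ℂ A :=
  p.prod.spectralMultiplier ι.actionRep fun x => p.prod.twist (K.prodMap (-K)) x x

theorem signMap_apply {x : T × T} {a : A} (ha : p.prod.IsHomogeneous ι.actionRep x a) :
    ι.signMap p K a = (p.prod.twist (K.prodMap (-K)) x x : ℂ) • a :=
  ha.spectralMultiplier_apply _

variable (ι p K) in
/-- The antipode of the deformed quantum group. -/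
noncomputable def deformedAntipode : Module.End ℂ A :=
  FiniteQuantumGroup.antipode ∘ₗ ι.signMap p K

theorem deformedAntipode_apply {x : T × T} {a : A} (ha : p.prod.IsHomogeneous ι.actionRep x a) :
    ι.deformedAntipode p K a =
      (p.prod.twist (K.prodMap (-K)) x x : ℂ) • FiniteQuantumGroup.antipode a := by
  rw [deformedAntipode, LinearMap.comp_apply, signMap_apply ha, LinearMap.map_smul]

theorem signMap_one (hK : ∀ x, p.twist K x x = 1) : ι.signMap p K = 1 := by
  rw [← p.prod.spectralMultiplier_one ι.actionRep, signMap]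
  congr 1
  ext x
  simp [twist_prodMap_neg, hK]

section Skew

variable (hK : p.IsSkewSymmetric K)
include hK

theorem signMap_signMap (a : A) : ι.signMap p K (ι.signMap p K a) = a := by
  have : ι.signMap p K ∘ₗ ι.signMap p K = LinearMap.id := by
    refine ext_homogeneous (p := p.prod) (β := ι.actionRep) fun x a ha => ?_
    rw [LinearMap.comp_apply, signMap_apply ha, LinearMap.map_smul, signMap_apply ha, smul_smul,
      ← Circle.coe_mul, twist_self_mul_self hK.prodMap_neg, Circle.coe_one, one_smul,
      LinearMap.id_apply]
  exact LinearMap.congr_fun this a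

theorem signMap_star (a : A) : ι.signMap p K (star a) = star (ι.signMap p K a) := by
  refine spectralMultiplier_star ι.isStarAction_actionRep (fun x => ?_) a
  rw [← starRingEnd_apply, ← Circle.coe_inv_eq_conj, twist_self_inv hK.prodMap_neg,
    twist_neg_left, twist_neg_right, inv_inv]

theorem signMap_antipode (a : A) : ι.signMap p K (FiniteQuantumGroup.antipode a) =
    FiniteQuantumGroup.antipode (ι.signMap p K a) := by
  have : ι.signMap p K ∘ₗ FiniteQuantumGroup.antipode =
      FiniteQuantumGroup.antipode ∘ₗ ι.signMap p K := by
    refine ext_homogeneous (p := p.prod) (β := ι.actionRep) fun x a ha => ?_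
    rw [LinearMap.comp_apply, LinearMap.comp_apply, signMap_apply (isHomogeneous_antipode ha),
      signMap_apply ha, LinearMap.map_smul]
    simp only [twist_prodMap_neg, Prod.fst_swap, Prod.snd_swap, twist_self_inv hK]
    rw [mul_comm]
  exact LinearMap.congr_fun this a

variable {m : A →ₗ[ℂ] A →ₗ[ℂ] A}
  (hm : ∀ x y a b, p.prod.IsHomogeneous ι.actionRep x a → p.prod.IsHomogeneous ι.actionRep y b →
    m a b = (p.prod.twist (K.prodMap (-K)) x y : ℂ) • (a * b))
include hm

omit hK in
theorem comul_deformed_mul (a b : A) : Coalgebra.comul (R := ℂ) (m a b) =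
    TensorProduct.map₂ m m (Coalgebra.comul a) (Coalgebra.comul b) := by
  have : m.compr₂ Coalgebra.comul = (TensorProduct.map₂ m m).compl₁₂ Coalgebra.comul
      Coalgebra.comul := by
    refine ext_homogeneous₂ (p := p.prod) (β := ι.actionRep) fun x z a b ha hb => ?_
    rw [LinearMap.compr₂_apply, LinearMap.compl₁₂_apply, hm x z a b ha hb, map_smul,
      FiniteQuantumGroup.comul_mul]
    symm
    refine comul_congr ha (F := (TensorProduct.map₂ m m).flip (Coalgebra.comul b))
      (G := (p.prod.twist (K.prodMap (-K)) x z : ℂ) •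
        (LinearMap.mul ℂ (A ⊗[ℂ] A)).flip (Coalgebra.comul b)) fun y u v hu hv => ?_
    refine comul_congr hb (F := TensorProduct.map₂ m m (u ⊗ₜ v))
      (G := (p.prod.twist (K.prodMap (-K)) x z : ℂ) •
        LinearMap.mul ℂ (A ⊗[ℂ] A) (u ⊗ₜ v)) fun w u' v' hu' hv' => ?_
    rw [TensorProduct.map₂_apply_tmul, TensorProduct.map_tmul, hm _ _ _ _ hu hu',
      hm _ _ _ _ hv hv', TensorProduct.smul_tmul_smul, LinearMap.smul_apply,
      LinearMap.mul_apply', Algebra.TensorProduct.tmul_mul_tmul, ← Circle.coe_mul]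
    refine congrArg (fun c : Circle => (c : ℂ) • (_ : A ⊗[ℂ] A)) ?_
    simp only [twist_prodMap_neg, twist_neg_left, twist_neg_right, inv_inv]
    rw [mul_assoc, inv_mul_cancel_left]
  exact LinearMap.congr_fun₂ this a b

omit hK hm in
theorem comul_signMap (a : A) : Coalgebra.comul (R := ℂ) (ι.signMap p K a) =
    TensorProduct.map (ι.signMap p K) (ι.signMap p K) (Coalgebra.comul a) := by
  have : Coalgebra.comul ∘ₗ ι.signMap p K =
      TensorProduct.map (ι.signMap p K) (ι.signMap p K) ∘ₗ Coalgebra.comul := by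
    refine ext_homogeneous (p := p.prod) (β := ι.actionRep) fun x a ha => ?_
    rw [LinearMap.comp_apply, LinearMap.comp_apply, signMap_apply ha, map_smul]
    symm
    refine comul_congr ha (F := TensorProduct.map (ι.signMap p K) (ι.signMap p K))
      (G := (p.prod.twist (K.prodMap (-K)) x x : ℂ) • LinearMap.id) fun y u v hu hv => ?_
    rw [TensorProduct.map_tmul, signMap_apply hu, signMap_apply hv, TensorProduct.smul_tmul_smul,
      LinearMap.smul_apply, LinearMap.id_apply, ← Circle.coe_mul]
    refine congrArg (fun c : Circle => (c : ℂ) • (_ : A ⊗[ℂ] A)) ?_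
    simp only [twist_prodMap_neg, twist_neg_left, twist_neg_right, inv_inv]
    rw [mul_assoc, inv_mul_cancel_left]
  exact LinearMap.congr_fun this a

omit hK in
theorem toCharacter_deformed_mul (t : T) (a b : A) :
    ι.toCharacter t (m a b) = ι.toCharacter t a * ι.toCharacter t b := by
  have : m.compr₂ (ι.toCharacter t : A →ₗ[ℂ] ℂ) = (LinearMap.mul ℂ ℂ).compl₁₂
      (ι.toCharacter t : A →ₗ[ℂ] ℂ) (ι.toCharacter t : A →ₗ[ℂ] ℂ) := by
    refine ext_homogeneous₂ (p := p.prod) (β := ι.actionRep) fun x z a b ha hb => ?_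
    change ι.toCharacter t (m a b) = ι.toCharacter t a * ι.toCharacter t b
    rw [hm x z a b ha hb, map_smul, map_mul]
    by_cases hx : x.1 = -x.2
    · by_cases hz : z.1 = -z.2
      · rw [twist_prodMap_neg, hx, hz, twist_neg_left, twist_neg_right, inv_inv, mul_inv_cancel,
          Circle.coe_one, one_smul]
      · rw [toCharacter_eq_zero hb hz, mul_zero, smul_zero]
    · rw [toCharacter_eq_zero ha hx, zero_mul, smul_zero]
  exact LinearMap.congr_fun₂ this a b

omit hm hK in
theorem toCharacter_signMap (t : T) (a : A) :
    ι.toCharacter t (ι.signMap p K a) = ι.toCharacter t a := by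
  have : (ι.toCharacter t : A →ₗ[ℂ] ℂ) ∘ₗ ι.signMap p K = (ι.toCharacter t : A →ₗ[ℂ] ℂ) := by
    refine ext_homogeneous (p := p.prod) (β := ι.actionRep) fun x a ha => ?_
    change ι.toCharacter t (ι.signMap p K a) = ι.toCharacter t a
    rw [signMap_apply ha, map_smul]
    by_cases hx : x.1 = -x.2
    · rw [twist_prodMap_neg, hx, twist_neg_left, twist_neg_right, inv_inv, mul_inv_cancel,
        Circle.coe_one, one_smul]
    · rw [toCharacter_eq_zero ha hx, smul_zero]
  exact LinearMap.congr_fun this a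

theorem deformedAntipode_mul (a b : A) : ι.deformedAntipode p K (m a b) =
    m (ι.deformedAntipode p K b) (ι.deformedAntipode p K a) := by
  have : m.compr₂ (ι.deformedAntipode p K) =
      m.flip.compl₁₂ (ι.deformedAntipode p K) (ι.deformedAntipode p K) := by
    refine ext_homogeneous₂ (p := p.prod) (β := ι.actionRep) fun x z a b ha hb => ?_
    rw [LinearMap.compr₂_apply, LinearMap.compl₁₂_apply, LinearMap.flip_apply, hm x z a b ha hb,
      map_smul, deformedAntipode_apply (ha.mul ι.isStarAction_actionRep hb),
      deformedAntipode_apply ha, deformedAntipode_apply hb,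
      hm _ _ _ _ ((isHomogeneous_antipode hb).smul _) ((isHomogeneous_antipode ha).smul _),
      FiniteQuantumGroup.antipode_mul, smul_mul_smul_comm, smul_smul, smul_smul,
      ← Circle.coe_mul, ← Circle.coe_mul, ← Circle.coe_mul]
    refine congrArg (fun c : Circle => (c : ℂ) • (_ : A)) ?_
    rw [twist_self_add hK.prodMap_neg, mul_comm (p.prod.twist _ x x)]
    congr 1
    rw [twist_prodMap_neg, twist_prodMap_neg, Prod.fst_swap, Prod.snd_swap, Prod.fst_swap,
      Prod.snd_swap, twist_swap hK x.2, twist_swap hK x.1, inv_inv, mul_comm]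
  exact LinearMap.congr_fun₂ this a b

omit hm in
theorem deformedAntipode_star (a : A) : ι.deformedAntipode p K (star (ι.signMap p K a)) =
    star (ι.signMap p K (ι.deformedAntipode p K a)) := by
  simp only [deformedAntipode, LinearMap.comp_apply, signMap_star hK, signMap_antipode hK,
    FiniteQuantumGroup.antipode_star]

omit hm in
theorem deformedAntipode_deformedAntipode (a : A) :
    ι.deformedAntipode p K (ι.deformedAntipode p K a) = a := by
  simp only [deformedAntipode, LinearMap.comp_apply, signMap_antipode hK, signMap_signMap hK,
    FiniteQuantumGroup.antipode_antipode]

omit hK hm [Fintype T] in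
theorem counit_eq_zero {x : T × T} {a : A} (ha : p.prod.IsHomogeneous ι.actionRep x a)
    (hx : x.1 ≠ -x.2) : Coalgebra.counit (R := ℂ) a = 0 := by
  rw [← ι.map_zero, toCharacter_eq_zero ha hx]

theorem lift_rTensor_deformedAntipode (a : A) :
    TensorProduct.lift m ((ι.deformedAntipode p K).rTensor A (Coalgebra.comul a)) =
      (Coalgebra.counit a : ℂ) • (1 : A) := by
  have : TensorProduct.lift m ∘ₗ (ι.deformedAntipode p K).rTensor A ∘ₗ Coalgebra.comul =
      LinearMap.toSpanSingleton ℂ A 1 ∘ₗ Coalgebra.counit := by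
    refine ext_homogeneous (p := p.prod) (β := ι.actionRep) fun x a ha => ?_
    refine (comul_congr ha (F := TensorProduct.lift m ∘ₗ (ι.deformedAntipode p K).rTensor A)
      (G := ((p.twist K x.1 x.1 * (p.twist K x.1 x.2)⁻¹ : Circle) : ℂ) •
        (LinearMap.mul' ℂ A ∘ₗ (FiniteQuantumGroup.antipode : A →ₗ[ℂ] A).rTensor A))
      fun y u v hu hv => ?_).trans ?_
    · simp only [LinearMap.comp_apply, LinearMap.rTensor_tmul, TensorProduct.lift.tmul,
        LinearMap.smul_apply, LinearMap.mul'_apply]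
      rw [deformedAntipode_apply hu, LinearMap.map_smul₂, hm _ _ _ _ (isHomogeneous_antipode hu) hv,
        smul_smul, ← Circle.coe_mul]
      refine congrArg (fun c : Circle => (c : ℂ) • (_ : A)) ?_
      simp only [twist_prodMap_neg, Prod.fst_swap, Prod.snd_swap, twist_neg_right,
        twist_self_inv hK]
      rw [mul_assoc, ← mul_assoc (p.twist K y y), twist_self_mul_self hK, one_mul]
    · simp only [LinearMap.smul_apply, LinearMap.comp_apply,
        FiniteQuantumGroup.mul_antipode_rTensor_comul, LinearMap.toSpanSingleton_apply]
      by_cases hx : x.1 = -x.2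
      · rw [hx, twist_neg_left, twist_neg_right, twist_neg_left, inv_inv,
          twist_self_mul_self hK, Circle.coe_one, one_smul]
      · rw [counit_eq_zero ha hx, zero_smul, smul_zero]
  exact LinearMap.congr_fun this a

theorem lift_lTensor_deformedAntipode (a : A) :
    TensorProduct.lift m ((ι.deformedAntipode p K).lTensor A (Coalgebra.comul a)) =
      (Coalgebra.counit a : ℂ) • (1 : A) := by
  have : TensorProduct.lift m ∘ₗ (ι.deformedAntipode p K).lTensor A ∘ₗ Coalgebra.comul =
      LinearMap.toSpanSingleton ℂ A 1 ∘ₗ Coalgebra.counit := by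
    refine ext_homogeneous (p := p.prod) (β := ι.actionRep) fun x a ha => ?_
    refine (comul_congr ha (F := TensorProduct.lift m ∘ₗ (ι.deformedAntipode p K).lTensor A)
      (G := ((p.twist K x.2 x.2 * p.twist K x.1 x.2 : Circle) : ℂ) •
        (LinearMap.mul' ℂ A ∘ₗ (FiniteQuantumGroup.antipode : A →ₗ[ℂ] A).lTensor A))
      fun y u v hu hv => ?_).trans ?_
    · simp only [LinearMap.comp_apply, LinearMap.lTensor_tmul, TensorProduct.lift.tmul,
        LinearMap.smul_apply, LinearMap.mul'_apply]
      rw [deformedAntipode_apply hv, map_smul, hm _ _ _ _ hu (isHomogeneous_antipode hv),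
        smul_smul, ← Circle.coe_mul]
      refine congrArg (fun c : Circle => (c : ℂ) • (_ : A)) ?_
      simp only [twist_prodMap_neg, Prod.fst_swap, Prod.snd_swap, twist_neg_left, twist_neg_right,
        twist_self_inv hK]
      rw [mul_comm (p.twist K y y), mul_mul_mul_comm, twist_self_mul_self hK, mul_one]
    · simp only [LinearMap.smul_apply, LinearMap.comp_apply,
        FiniteQuantumGroup.mul_antipode_lTensor_comul, LinearMap.toSpanSingleton_apply]
      by_cases hx : x.1 = -x.2
      · rw [hx, twist_neg_left, mul_inv_cancel, Circle.coe_one, one_smul]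
      · rw [counit_eq_zero ha hx, zero_smul, smul_zero]
  exact LinearMap.congr_fun this a

theorem isDeformation : ι.IsDeformation m (ι.signMap p K) (ι.deformedAntipode p K) where
  comul_mul := comul_deformed_mul hm
  comul_sign := comul_signMap
  toCharacter_mul := toCharacter_deformed_mul hm
  toCharacter_sign := toCharacter_signMap
  antipode_mul := deformedAntipode_mul hK hm
  antipode_star := deformedAntipode_star hK
  antipode_antipode := deformedAntipode_deformedAntipode hK
  lift_antipode_rTensor := lift_rTensor_deformedAntipode hK hm
  lift_antipode_lTensor := lift_lTensor_deformedAntipode hK hm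

end Skew

theorem deformsTo_product (ι : CharacterSubgroup T A) {S : T ≃+ T}
    (hS : p.IsSkewSymmetric S.toAddMonoidHom) :
    ι.DeformsTo (ι.product p S.toAddMonoidHom)
      (fun a => star (ι.signMap p S.symm.toAddMonoidHom a))
      (ι.deformedAntipode p S.symm.toAddMonoidHom) := by
  have hm : ∀ x y a b, p.prod.IsHomogeneous ι.actionRep x a →
      p.prod.IsHomogeneous ι.actionRep y b →
      p.prod.deformedMul ι.actionRep (S.toAddMonoidHom.prodMap (-S.toAddMonoidHom)) a b =
        (p.prod.twist (S.symm.toAddMonoidHom.prodMap (-S.symm.toAddMonoidHom)) x y : ℂ) •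
          (a * b) := fun x y a b ha hb =>
    deformedMul_of_homogeneous (fun x => by ext <;> simp) (fun x => by ext <;> simp) ha hb
  let := CStarAlgebra.spectralOrder A
  have := CStarAlgebra.spectralOrderedRing A
  let M : A →ₗ[ℂ] CStarMatrix (Fin (Fintype.card (T × T))) (Fin (Fintype.card (T × T))) A :=
    p.prod.twistedMatrix (S.symm.toAddMonoidHom.prodMap (-S.symm.toAddMonoidHom)) ι.actionRep
      (Fintype.equivFin (T × T)).symm
  have hM_star : ∀ a, M (star (ι.signMap p S.symm.toAddMonoidHom a)) = star (M a) :=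
    twistedMatrix_star _ ι.isStarAction_actionRep hS.symm.prodMap_neg
  have h := (isDeformation hS.symm hm).deformsTo (M := M) (twistedMatrix_injective _ _ _ _)
    (twistedMatrix_deformedMul _ ι.isStarAction_actionRep hm)
    (twistedMatrix_one _ ι.isStarAction_actionRep) hM_star
  simp only [deformedMul_apply] at h
  exact h

end CharacterSubgroup

theorem theorem3p2 {A : Type u} [FiniteQuantumGroup A] {T : Type v} [AddCommGroup T] [Fintype T]
    (ι : CharacterSubgroup T A) (p : PontryaginPairing T) (S : T ≃+ T)
    (hS : p.IsSkewSymmetric S.toAddMonoidHom) :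
    ((∀ s : T, p.toFun (S s) s = 1) →
      ι.DeformsTo (ι.product p S.toAddMonoidHom) star
        (FiniteQuantumGroup.antipode : A →ₗ[ℂ] A)) ∧
    ∃ (inv κ : A → A), ι.DeformsTo (ι.product p S.toAddMonoidHom) inv κ := by
  have h := ι.deformsTo_product hS
  refine ⟨fun h1 => ?_, _, _, h⟩
  have hK : ∀ x, p.twist S.symm.toAddMonoidHom x x = 1 := fun x => by
    have := h1 (S.symm x)
    rw [S.apply_symm_apply, p.symm] at this
    change p.toFun (-(S.symm x)) x = 1
    rw [p.toFun_neg_left, this, inv_one]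
  rw [CharacterSubgroup.deformedAntipode, CharacterSubgroup.signMap_one hK] at h
  exact h
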